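/- **Model.** Let $J$ and $r_1,\dots,r_J$ be fixed. For $i=1,\dots,N$ and $t=1,\dots,T$ one observes $x_{it}=\lambda_{ji}'f_t+e_{it}$ if $z_t=j$, where $z_t\in\{1,\dots,J\}$ is an unobserved state, $\lambda_{ji}\in\mathbb R^{r_j}$ are nonrandom loadings, $f_t\in\mathbb R^{r_{z_t}}$ are unobserved random factors and $e_{it}$ are errors. Write $x_t=(x_{1t},\dots,x_{Nt})'$, $\Lambda_j=(\lambda_{j1},\dots,\lambda_{jN})'$ and $M_A=I-A(A'A)^{-1}A'$; $(N,T)\to\infty$ means that $N$ and $T$ tend to infinity jointly. **Assumptions.** For constants $\alpha>16$, $\beta\ge 2$, $M<\infty$, $C>0$ and $q_j^0$: * (A1) For each $j$, $\frac1{Tq_j^0}\sum_{t\le T}f_tf_t'1_{z_t=j}$ converges in probability to a positive definite matrix; and for every $c>0$ there is $\kappa>0$ such that, with probability approaching one as $T\to\infty$, the smallest eigenvalue of $\frac1{|A|}\sum_{t\in A}f_tf_t'$ is at least $\kappa$ for all (possibly data-dependent) $A\subseteq\{t\le T:z_t=j\}$ with $|A|\ge cTq_j^0$. Moreover $\mathbb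 E\|f_t\|^\alpha\le M$ for all $t$. * (A2) $\frac1N\Lambda_j'\Lambda_j$ converges to a positive definite matrix and $\|\lambda_{ji}\|\le M$, for all $i,j$; and for all $j\ne k$ and all large $N$, almost surely $\frac1Nf_t'\Lambda_j'M_{\Lambda_k}\Lambda_jf_t\ge C$ for all $t$ with $z_t=j$. * (A3) $\mathbb E e_{it}=0$ and $\mathbb E|e_{it}|^\alpha\le M$; $|\mathbb E(e_{it}e_{kt})|\le\tau_{ik}$ for all $t$, with $\tau_{ik}>0$ and $\sum_{k\le N}\tau_{ik}\le M$ for all $i,N$; $|\mathbb E(e_{it}e_{is})|\le\gamma_{ts}$ for all $i$, with $\gamma_{ts}>0$ and $\sum_{s\le T}\gamma_{ts}\le M$ for all $t,T$; and $\mathbb E\big(\frac1{\sqrt T}\sum_{t\le T}(e_{it}e_{kt}-\mathbb E(e_{it}e_{kt}))1_{z_t=j}\big)^2\le M$ for all $i,k,j,T$. * (A4) $\frac1T\sum_{t\le T}1_{z_t=j}\to q_j^0$ in probability, with $0<q_j^0<1$, for all $j$. * (A5) $\mathbb E\big\|\frac1{\sqrt N}\sum_{i\le N}\lambda_{ji}e_{it}\big\|^\beta\le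 M$ for all $j,t,N$. **Estimator.** Let $L(x;\Lambda_j,\sigma^2)$ be the $N(0,\Lambda_j\Lambda_j'+\sigma^2I_N)$ density at $x$. Given weights $q_j>0$ with $\sum_jq_j=1$ (any constants, or random weights bounded away from zero in probability) and any $\hat\sigma^2>0$ that is bounded and bounded away from zero in probability, let $\hat\Lambda=(\hat\Lambda_1,\dots,\hat\Lambda_J)$, with $\hat\Lambda_j\in\mathbb R^{N\times r_j}$, maximize the quasi log-likelihood $\sum_{t\le T}\log\sum_jq_jL(x_t;\Lambda_j,\hat\sigma^2)$ over $\Lambda$, and let $$\hat p_{tj}=\frac{q_jL(x_t;\hat\Lambda_j,\hat\sigma^2)}{\sum_kq_kL(x_t;\hat\Lambda_k,\hat\sigma^2)}.$$ **Theorem.** After a relabeling of the estimated regimes (a permutation $\pi$ of $\{1,\dots,J\}$ with $r_{\pi(j)}=r_j$, which may depend on $N$, $T$ and the sample, but not on $t$, $j$ or $\eta$; $\hat p_{tj}$ below stands for $\hat p_{t\pi(j)}$), as $(N,T)\to\infty$, for each $j$ and every $\eta>0$: 1. $\sup_{t\le T}|\hat p_{tj}-1_{z_t=j}|=o_p(N^{-\eta})$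 if $T^{16/\alpha}/N\to0$ and $T^{2/\alpha+2/\beta}/N\to0$; 2. $|\hat p_{tj}-1_{z_t=j}|=o_p(N^{-\eta})$ for each single $t\le T$ (fixed, or any nonrandom $t=t_{N,T}$), with no restriction on the relative growth of $N$ and $T$. -/

import Mathlib

open MeasureTheory Filter Topology Matrix

noncomputable section

namespace RegimeFactor

/-- Data of a factor model with regime switching in the loadings, on a probability space `(Ω, P)`.
Times and cross-sectional units are numbered `0, 1, 2, …`; a sample of size `(N, T)` uses the units
`i < N` and the times `t < T`. -/
structure Model (Ω : Type*) [MeasurableSpace Ω] where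
  /-- number of regimes -/
  J : ℕ
  /-- number of factors in each regime -/
  r : Fin J → ℕ
  /-- the loading vector of regime `j` for unit `i` -/
  lam : (j : Fin J) → ℕ → EuclideanSpace ℝ (Fin (r j))
  /-- the state (regime) at time `t` -/
  z : ℕ → Ω → Fin J
  /-- the factor vector at time `t` is `F t ω (z t ω)`, a vector of dimension `r (z t ω)`;
  the components `F t ω j` with `j ≠ z t ω` never matter -/
  F : ℕ → Ω → (j : Fin J) → EuclideanSpace ℝ (Fin (r j))
  /-- the error term of unit `i` at time `t` -/
  e : ℕ → ℕ → Ω → ℝ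
  measurable_z : ∀ t, Measurable (z t)
  measurable_F : ∀ t j, Measurable (fun ω => F t ω j)
  measurable_e : ∀ i t, Measurable (e i t)

/-- `E X` for a nonnegative random variable `X`, with values in `[0, ∞]`. -/
def expNonneg {Ω : Type*} [MeasurableSpace Ω] (P : Measure Ω) (X : Ω → ℝ) : ENNReal :=
  ∫⁻ ω, ENNReal.ofReal (X ω) ∂P

/-- `X_n = o_p(a_n)` along the filter `l`: `X_n / a_n` converges to `0` in probability. -/
def IsLittleOp {Ω ι : Type*} [MeasurableSpace Ω] (P : Measure Ω) (l : Filter ι)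
    (X : ι → Ω → ℝ) (a : ι → ℝ) : Prop :=
  TendstoInMeasure P (fun n ω => X n ω / a n) l (fun _ => (0 : ℝ))

/-- `M_A = I - A (A' A)⁻¹ A'`, the projection onto the orthogonal complement of the columns of `A`
(when these are linearly independent). -/
def annihilator {N k : ℕ} (A : Matrix (Fin N) (Fin k) ℝ) : Matrix (Fin N) (Fin N) ℝ :=
  1 - A * (Aᵀ * A)⁻¹ * Aᵀ

namespace Model

variable {Ω : Type*} [MeasurableSpace Ω] (m : Model Ω)

/-- The `N × r_j` matrix of true loadings of regime `j`. -/
def loading (N : ℕ) (j : Fin m.J) : Matrix (Fin N) (Fin (m.r j)) ℝ :=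
  Matrix.of fun i a => m.lam j (i : ℕ) a

/-- The observation `x_t = Λ_j f_t + e_t` if `z_t = j`. -/
def obs (N : ℕ) (t : ℕ) (ω : Ω) : Fin N → ℝ :=
  fun i => (m.loading N (m.z t ω) *ᵥ (fun a => m.F t ω (m.z t ω) a)) i + m.e i t ω

/-- The indicator of `z_t = j`. -/
def ind (t : ℕ) (j : Fin m.J) (ω : Ω) : ℝ := if m.z t ω = j then 1 else 0

/-! ### Assumptions on the model -/

/-- Second moments of the factors within a regime. First, `(T q_j)⁻¹ ∑_t f_t f_t' 1{z_t = j}`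
converges in probability to a positive definite matrix. Second, the same nondegeneracy holds along
all (possibly data dependent) subsets `A` of `{t < T : z_t = j}` of asymptotically non-negligible
size: for every `c > 0` there is `κ > 0` such that with probability approaching one, the smallest
eigenvalue of `|A|⁻¹ ∑_{t ∈ A} f_t f_t'` is at least `κ` for all such `A` with `|A| ≥ c T q_j`. -/
def FactorSecondMoments (P : Measure Ω) (q0 : Fin m.J → ℝ) : Prop :=
  (∀ j, ∃ S : Matrix (Fin (m.r j)) (Fin (m.r j)) ℝ, S.PosDef ∧
    ∀ a b, TendstoInMeasure P
      (fun (T : ℕ) ω => (T * q0 j)⁻¹ *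
        ∑ t ∈ Finset.range T, m.F t ω j a * m.F t ω j b * m.ind t j ω)
      atTop (fun _ => S a b)) ∧
  (∀ j, ∀ c : ℝ, 0 < c → ∃ κ : ℝ, 0 < κ ∧
    Tendsto (fun T : ℕ => P {ω | ¬ ∀ A : Finset ℕ, A ⊆ Finset.range T →
        (∀ t ∈ A, m.z t ω = j) → c * (T * q0 j) ≤ (A.card : ℝ) →
        ∀ v : EuclideanSpace ℝ (Fin (m.r j)),
          κ * ‖v‖ ^ 2 ≤ (A.card : ℝ)⁻¹ * ∑ t ∈ A, (inner ℝ (m.F t ω j) v) ^ 2})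
      atTop (𝓝 0))

/-- `E ‖f_t‖^α ≤ M` for all `t`. -/
def FactorMoments (P : Measure Ω) (α : ℝ) : Prop :=
  ∃ M : ℝ, ∀ t, expNonneg P (fun ω => ‖m.F t ω (m.z t ω)‖ ^ α) ≤ ENNReal.ofReal M

/-- `N⁻¹ Λ_j' Λ_j` converges to a positive definite matrix and the loadings are bounded. -/
def LoadingLimits : Prop :=
  (∀ j, ∃ S : Matrix (Fin (m.r j)) (Fin (m.r j)) ℝ, S.PosDef ∧
    Tendsto (fun N : ℕ => (N : ℝ)⁻¹ • ((m.loading N j)ᵀ * m.loading N j)) atTop (𝓝 S)) ∧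
  (∃ M : ℝ, ∀ j i, ‖m.lam j i‖ ≤ M)

/-- Identification of regimes: for `j ≠ k`, `N⁻¹ f_t' Λ_j' M_{Λ_k} Λ_j f_t ≥ C > 0` for all `t` in
regime `j`, for all large `N`. -/
def RegimesSeparated (P : Measure Ω) : Prop :=
  ∃ C : ℝ, 0 < C ∧ ∀ j k, j ≠ k → ∀ᶠ N : ℕ in atTop, ∀ᵐ ω ∂P, ∀ t, m.z t ω = j →
    C ≤ (N : ℝ)⁻¹ * ((fun a => m.F t ω j a) ⬝ᵥ
      (((m.loading N j)ᵀ * annihilator (m.loading N k) * m.loading N j) *ᵥ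
        (fun a => m.F t ω j a)))

/-- `E e_it = 0` and `E |e_it|^α ≤ M`. -/
def ErrorMoments (P : Measure Ω) (α : ℝ) : Prop :=
  (∀ i t, ∫ ω, m.e i t ω ∂P = 0) ∧
  ∃ M : ℝ, ∀ i t, expNonneg P (fun ω => |m.e i t ω| ^ α) ≤ ENNReal.ofReal M

/-- Weak cross-sectional dependence of the errors. -/
def ErrorCrossSection (P : Measure Ω) : Prop :=
  ∃ (M : ℝ) (τ : ℕ → ℕ → ℝ), (∀ i k, 0 < τ i k) ∧
    (∀ i k t, |∫ ω, m.e i t ω * m.e k t ω ∂P| ≤ τ i k) ∧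
    (∀ i N : ℕ, ∑ k ∈ Finset.range N, τ i k ≤ M)

/-- Weak serial dependence of the errors. -/
def ErrorSerial (P : Measure Ω) : Prop :=
  ∃ (M : ℝ) (γ : ℕ → ℕ → ℝ), (∀ t s, 0 < γ t s) ∧
    (∀ i t s, |∫ ω, m.e i t ω * m.e i s ω ∂P| ≤ γ t s) ∧
    (∀ t T : ℕ, ∑ s ∈ Finset.range T, γ t s ≤ M)

/-- `E (T^{-1/2} ∑_t (e_it e_kt - E(e_it e_kt)) 1{z_t = j})² ≤ M`. -/
def ErrorFluctuation (P : Measure Ω) : Prop :=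
  ∃ M : ℝ, ∀ (i k T : ℕ) (j : Fin m.J),
    expNonneg P (fun ω => ((Real.sqrt T)⁻¹ * ∑ t ∈ Finset.range T,
      (m.e i t ω * m.e k t ω - ∫ ω', m.e i t ω' * m.e k t ω' ∂P) * m.ind t j ω) ^ 2)
      ≤ ENNReal.ofReal M

/-- `T⁻¹ ∑_t 1{z_t = j}` converges in probability to `q_j ∈ (0, 1)`. -/
def StateFrequencies (P : Measure Ω) (q0 : Fin m.J → ℝ) : Prop :=
  ∀ j, TendstoInMeasure P
      (fun (T : ℕ) ω => (T : ℝ)⁻¹ * ∑ t ∈ Finset.range T, m.ind t j ω) atTop (fun _ => q0 j) ∧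
    0 < q0 j ∧ q0 j < 1

/-- `E ‖N^{-1/2} ∑_i λ_ji e_it‖^β ≤ M`. -/
def LoadingErrorMoments (P : Measure Ω) (β : ℝ) : Prop :=
  ∃ M : ℝ, ∀ (j : Fin m.J) (t N : ℕ),
    expNonneg P (fun ω =>
      ‖(Real.sqrt N)⁻¹ • ∑ i ∈ Finset.range N, m.e i t ω • m.lam j i‖ ^ β) ≤ ENNReal.ofReal M

/-! ### The quasi maximum likelihood estimator and the estimated regime probabilities -/

/-- A candidate value `(Λ_1, …, Λ_J)` of the loadings of the first `N` units. -/
abbrev Loadings (N : ℕ) : Type := (j : Fin m.J) → Matrix (Fin N) (Fin (m.r j)) ℝ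

end Model

/-- The Gaussian density `L(x | z = j; Λ, σ²)` with covariance matrix `Σ = Λ Λ' + σ² I`. -/
def density {N k : ℕ} (A : Matrix (Fin N) (Fin k) ℝ) (s2 : ℝ) (x : Fin N → ℝ) : ℝ :=
  let S : Matrix (Fin N) (Fin N) ℝ := A * Aᵀ + s2 • 1
  (2 * Real.pi) ^ (-(N : ℝ) / 2) * S.det ^ (-(1 : ℝ) / 2) *
    Real.exp (-(1 / 2) * (x ⬝ᵥ (S⁻¹ *ᵥ x)))

namespace Model

variable {Ω : Type*} [MeasurableSpace Ω] (m : Model Ω)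

/-- The log-likelihood `∑_t log (∑_j q_j L(x_t | z_t = j; Λ_j, σ²))` at the sample `ω`. -/
def logLik (N T : ℕ) (ω : Ω) (L : m.Loadings N) (s2 : ℝ) (q : Fin m.J → ℝ) : ℝ :=
  ∑ t ∈ Finset.range T, Real.log (∑ j, q j * density (L j) s2 (m.obs N t ω))

/-- The regime probability `Pr(z_t = j | x_t; Λ, q, σ²)` by Bayes' formula. -/
def regimeProb (N : ℕ) (ω : Ω) (L : m.Loadings N) (s2 : ℝ) (q : Fin m.J → ℝ)
    (t : ℕ) (j : Fin m.J) : ℝ :=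
  q j * density (L j) s2 (m.obs N t ω) / ∑ k, q k * density (L k) s2 (m.obs N t ω)

/-- An estimator: for every sample size `(N, T)` and every outcome, loadings `Λ̂`, a variance `σ̂²`
and the regime weights `q` that enter the likelihood. -/
structure Estimator where
  Lhat : (N T : ℕ) → Ω → m.Loadings N
  s2 : ℕ → ℕ → Ω → ℝ
  q : ℕ → ℕ → Ω → Fin m.J → ℝ

variable {m}

/-- `p̂_tj`, the regime probability at the estimated parameters. -/
def Estimator.pHat (E : m.Estimator) (N T : ℕ) (t : ℕ) (j : Fin m.J) (ω : Ω) : ℝ :=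
  m.regimeProb N ω (E.Lhat N T ω) (E.s2 N T ω) (E.q N T ω) t j

/-- Quasi maximum likelihood estimator: the loadings maximize the likelihood given `(σ̂², q)`. The
weights `q` are positive, sum to one and are bounded away from zero in probability; `σ̂²` is positive
and bounded and bounded away from zero in probability. This covers any constant positive `q`,
`σ̂²` fixed at `1`, and joint maximization over `σ² ∈ [C⁻², C²]`. (Normalizing `Λ̂_j' Λ̂_j` to be
diagonal is a rotation of `Λ̂_j`, which changes neither the likelihood nor `p̂_tj`.) -/
structure Estimator.IsQML (E : m.Estimator) (P : Measure Ω) : Prop where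
  maximizes : ∀ N T ω, ∀ L : m.Loadings N,
    m.logLik N T ω L (E.s2 N T ω) (E.q N T ω) ≤
      m.logLik N T ω (E.Lhat N T ω) (E.s2 N T ω) (E.q N T ω)
  s2_pos : ∀ N T ω, 0 < E.s2 N T ω
  s2_bounded : ∀ δ : ℝ, 0 < δ → ∃ C : ℝ, 0 < C ∧ ∀ᶠ n : ℕ × ℕ in atTop ×ˢ atTop,
    P {ω | ¬ (C⁻¹ ≤ E.s2 n.1 n.2 ω ∧ E.s2 n.1 n.2 ω ≤ C)} ≤ ENNReal.ofReal δ
  q_pos : ∀ N T ω j, 0 < E.q N T ω j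
  q_sum : ∀ N T ω, ∑ j, E.q N T ω j = 1
  q_bounded : ∀ δ : ℝ, 0 < δ → ∃ c : ℝ, 0 < c ∧ ∀ᶠ n : ℕ × ℕ in atTop ×ˢ atTop,
    P {ω | ¬ ∀ j, c ≤ E.q n.1 n.2 ω j} ≤ ENNReal.ofReal δ

end Model

end RegimeFactor

end

/-!
Up to constants, minus twice the log of the density `L(x; Λ, σ²)` is the cost
`log det (I + Λ' Λ / σ²) + min_g (‖x - Λ g‖² / σ² + ‖g‖²)` (`density_eq`, `exists_quadForm_eq`), so
maximizing the likelihood is a clustering problem with a penalized linear fit in each cluster.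

*The estimated loading spaces are close to the true ones.* Assign every time `t` to the estimated
regime that explains it best. Comparing the maximum of the likelihood with its value at the true
loadings shows that the average over `t` of the log-determinant, of `‖g_t‖²` and of the squared
distance between the true and the fitted common component is `O_p(log N + N / √T)`
(`sum_excess_le`). The errors can only contribute through their components along spaces of bounded
dimension, and the second moment matrix of the errors has operator norm `O_p(1 + N / √T)`
(`sum_inner_errVec_sq_le`). By the pigeonhole principle, each true regime `j` has an estimated
regime `σ j` to which a positive share of its times is assigned; as the factors are nondegenerate
along any such share, the average fit extends to all of the loading space (`exists_fits`).

*Labels.* Approximate containment of the loading space of `j` in the one of `σ j` gives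
`r j ≤ r (σ j)`, and two regimes with the same image have strictly smaller rank than their image,
because otherwise separation would fail. Such a `σ` is a rank preserving permutation
(`bijective_of_rank`), and containment can then be reversed (`exists_approx_of_finrank_le`).

*Posterior probabilities.* Take a time in regime `j` whose factor, error and loading-weighted error
are not too large compared with the rate of the loading spaces. The right estimated regime
has cost at most `‖e_t‖² / σ² + o(N)`, while every other one has cost at least
`‖e_t‖² / σ² + c N` (`norm_sq_le_of_close`, `norm_sq_ge_of_separated`). Hence the posterior
probabilities are within `O(exp (-γ N))` of the indicators, which beats every power of `N`.
Over a set of `ρ` times, the maxima of these quantities are controlled by Markov's inequality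
(`exists_measure_max_le`), and they are small enough under the two growth conditions with `ρ` in
place of `T`. Uniform convergence is the case of all times, `ρ = T`; pointwise convergence is the
case `ρ = 1`, for which the growth conditions hold trivially.
-/

noncomputable section

namespace RegimeFactor

/-! ### The Gaussian density as a penalized residual -/

/-- `log det (A A' + σ² I) - N log σ²`, which is `log det (I + A' A / σ²)`. -/
def logDetExcess {N k : ℕ} (A : Matrix (Fin N) (Fin k) ℝ) (s2 : ℝ) : ℝ :=
  Real.log (A * Aᵀ + s2 • (1 : Matrix (Fin N) (Fin N) ℝ)).det - N * Real.log s2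

/-- Minus twice the Gaussian log-density, without its part that does not depend on the loadings. -/
def cost {N k : ℕ} (A : Matrix (Fin N) (Fin k) ℝ) (s2 : ℝ) (x : Fin N → ℝ) : ℝ :=
  logDetExcess A s2 + x ⬝ᵥ ((A * Aᵀ + s2 • (1 : Matrix (Fin N) (Fin N) ℝ))⁻¹ *ᵥ x)

section

variable {N k : ℕ} (A : Matrix (Fin N) (Fin k) ℝ) {s2 : ℝ}

lemma dotProduct_covariance_mulVec (v : Fin N → ℝ) :
    v ⬝ᵥ ((A * Aᵀ + s2 • (1 : Matrix (Fin N) (Fin N) ℝ)) *ᵥ v)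
      = (Aᵀ *ᵥ v) ⬝ᵥ (Aᵀ *ᵥ v) + s2 * (v ⬝ᵥ v) := by
  rw [add_mulVec, dotProduct_add, smul_mulVec, one_mulVec, dotProduct_smul, ← mulVec_mulVec,
    dotProduct_mulVec, ← mulVec_transpose, smul_eq_mul]

lemma posDef_covariance (hs : 0 < s2) :
    (A * Aᵀ + s2 • (1 : Matrix (Fin N) (Fin N) ℝ)).PosDef := by
  apply Matrix.PosDef.posSemidef_add
  · simpa using Matrix.posSemidef_self_mul_conjTranspose A
  · exact Matrix.PosDef.one.smul hs

lemma pow_le_det_covariance (hs : 0 < s2) :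
    s2 ^ N ≤ (A * Aᵀ + s2 • (1 : Matrix (Fin N) (Fin N) ℝ)).det := by
  have hpd := posDef_covariance A hs
  have hH := hpd.isHermitian
  rw [hH.det_eq_prod_eigenvalues]
  have key : ∀ i, s2 ≤ hH.eigenvalues i := by
    intro i
    rw [hH.eigenvalues_eq]
    have hv : (hH.eigenvectorBasis i).ofLp ⬝ᵥ (hH.eigenvectorBasis i).ofLp = 1 := by
      have h1 := hH.eigenvectorBasis.orthonormal.1 i
      have h2 : ‖hH.eigenvectorBasis i‖ ^ 2 = 1 := by rw [h1]; norm_num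
      rw [EuclideanSpace.real_norm_sq_eq] at h2
      rw [← h2]; simp [dotProduct, sq]
    have := dotProduct_covariance_mulVec A (s2 := s2) (hH.eigenvectorBasis i).ofLp
    simp only [star_trivial, RCLike.re_to_real]
    rw [this, hv, mul_one]
    exact le_add_of_nonneg_left (Finset.sum_nonneg fun j _ => mul_self_nonneg _)
  calc s2 ^ N = ∏ _i : Fin N, s2 := by simp
    _ ≤ ∏ i, hH.eigenvalues i := Finset.prod_le_prod (fun _ _ => hs.le) (fun i _ => key i)
    _ = _ := by simp

lemma logDetExcess_nonneg (hs : 0 < s2) : 0 ≤ logDetExcess A s2 := by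
  rw [logDetExcess, ← Real.log_pow, sub_nonneg]
  exact Real.log_le_log (pow_pos hs N) (pow_le_det_covariance A hs)

/-- By the Weinstein–Aronszajn identity the determinant is `k × k`, hence grows only polynomially
in `N`. -/
lemma logDetExcess_le (hs : 0 < s2) {K : ℝ} (hA : ∀ i a, |A i a| ≤ K) :
    logDetExcess A s2 ≤ Real.log k.factorial + k * Real.log (1 + s2⁻¹ * (N * K ^ 2)) := by
  have hdet : (A * Aᵀ + s2 • (1 : Matrix (Fin N) (Fin N) ℝ)).det
      = s2 ^ N * (1 + (s2⁻¹ • Aᵀ) * A).det := by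
    have : A * Aᵀ + s2 • (1 : Matrix (Fin N) (Fin N) ℝ) = s2 • (1 + A * (s2⁻¹ • Aᵀ)) := by
      rw [smul_add, Matrix.mul_smul, smul_smul, mul_inv_cancel₀ hs.ne', one_smul, add_comm]
    rw [this, Matrix.det_smul, Matrix.det_one_add_mul_comm]
    simp
  have hpos := (pow_pos hs N).trans_le (pow_le_det_covariance A hs)
  have hd : 0 < (1 + (s2⁻¹ • Aᵀ) * A).det := by
    rw [hdet] at hpos
    exact pos_of_mul_pos_right hpos (pow_pos hs N).le
  have hKn : 0 ≤ s2⁻¹ * (N * K ^ 2) := by positivity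
  have hle : (1 + (s2⁻¹ • Aᵀ) * A).det ≤ k.factorial * (1 + s2⁻¹ * (N * K ^ 2)) ^ k := by
    have := Matrix.det_le (A := 1 + (s2⁻¹ • Aᵀ) * A) (abv := AbsoluteValue.abs)
      (x := 1 + s2⁻¹ * (N * K ^ 2)) (by
        intro a b
        have h1 : |(1 : Matrix (Fin k) (Fin k) ℝ) a b| ≤ 1 := by
          rw [Matrix.one_apply]; split_ifs <;> simp
        have h2 : |((s2⁻¹ • Aᵀ) * A) a b| ≤ s2⁻¹ * (N * K ^ 2) := by
          rw [Matrix.smul_mul, Matrix.smul_apply, smul_eq_mul, abs_mul, abs_of_pos (inv_pos.2 hs)]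
          refine mul_le_mul_of_nonneg_left ?_ (inv_pos.2 hs).le
          rw [Matrix.mul_apply]
          refine (Finset.abs_sum_le_sum_abs _ _).trans ?_
          calc ∑ i, |Aᵀ a i * A i b| ≤ ∑ _i : Fin N, K ^ 2 := by
                refine Finset.sum_le_sum fun i _ => ?_
                rw [abs_mul, sq]
                exact mul_le_mul (hA i a) (hA i b) (abs_nonneg _) ((abs_nonneg _).trans (hA i a))
            _ = N * K ^ 2 := by simp
        simpa using (abs_add_le _ _).trans (add_le_add h1 h2))
    simp only [AbsoluteValue.abs_apply, Fintype.card_fin, nsmul_eq_mul] at this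
    exact (le_abs_self _).trans this
  rw [logDetExcess, hdet, Real.log_mul (pow_pos hs N).ne' hd.ne', Real.log_pow, add_sub_cancel_left]
  refine (Real.log_le_log hd hle).trans ?_
  rw [Real.log_mul (by positivity) (by positivity), Real.log_pow]

lemma density_eq (hs : 0 < s2) (x : Fin N → ℝ) :
    density A s2 x = ((2 * Real.pi) ^ (-(N : ℝ) / 2) * s2 ^ (-(N : ℝ) / 2)) *
      Real.exp (-(1 / 2) * cost A s2 x) := by
  have hpos := (pow_pos hs N).trans_le (pow_le_det_covariance A hs)
  simp only [density, cost, logDetExcess]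
  rw [Real.rpow_def_of_pos hpos, Real.rpow_def_of_pos hs, mul_assoc, mul_assoc, ← Real.exp_add,
    ← Real.exp_add]
  congr 2
  ring

lemma density_pos (hs : 0 < s2) (x : Fin N → ℝ) : 0 < density A s2 x := by
  rw [density_eq A hs]; positivity

lemma covariance_mulVec_inv (hs : 0 < s2) (x : Fin N → ℝ) :
    (A * Aᵀ + s2 • (1 : Matrix (Fin N) (Fin N) ℝ)) *ᵥ
      ((A * Aᵀ + s2 • (1 : Matrix (Fin N) (Fin N) ℝ))⁻¹ *ᵥ x) = x := by
  have := (posDef_covariance A hs).isUnit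
  rw [mulVec_mulVec, Matrix.mul_nonsing_inv _ ((Matrix.isUnit_iff_isUnit_det _).1 this),
    one_mulVec]

lemma ofLp_toEuclideanLin (v : EuclideanSpace ℝ (Fin k)) :
    (Matrix.toEuclideanLin A v).ofLp = A *ᵥ v.ofLp := rfl

lemma norm_sq_eq_dotProduct {n : ℕ} (v : EuclideanSpace ℝ (Fin n)) :
    ‖v‖ ^ 2 = v.ofLp ⬝ᵥ v.ofLp := by
  rw [EuclideanSpace.real_norm_sq_eq]; simp [dotProduct, sq]

/-- The quadratic form of the Gaussian density is the minimum of a ridge regression criterion: with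
`y = Σ⁻¹ x`, the coefficient `A' y` attains the minimum. -/
lemma quadForm_eq (hs : 0 < s2) (x : EuclideanSpace ℝ (Fin N)) (g : EuclideanSpace ℝ (Fin k)) :
    ‖x - Matrix.toEuclideanLin A g‖ ^ 2 / s2 + ‖g‖ ^ 2
      = x.ofLp ⬝ᵥ ((A * Aᵀ + s2 • (1 : Matrix (Fin N) (Fin N) ℝ))⁻¹ *ᵥ x.ofLp)
        + (let h := g - WithLp.toLp 2
              (Aᵀ *ᵥ ((A * Aᵀ + s2 • (1 : Matrix (Fin N) (Fin N) ℝ))⁻¹ *ᵥ x.ofLp))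
          ‖Matrix.toEuclideanLin A h‖ ^ 2 / s2 + ‖h‖ ^ 2) := by
  have hx := covariance_mulVec_inv A hs x.ofLp
  set y := (A * Aᵀ + s2 • (1 : Matrix (Fin N) (Fin N) ℝ))⁻¹ *ᵥ x.ofLp
  have hx' : x.ofLp = A *ᵥ (Aᵀ *ᵥ y) + s2 • y := by
    rw [← hx, add_mulVec, ← mulVec_mulVec, smul_mulVec, one_mulVec]
  set p := Aᵀ *ᵥ y with hp
  obtain ⟨h, rfl⟩ : ∃ h, g = WithLp.toLp 2 p + h := ⟨g - WithLp.toLp 2 p, by abel⟩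
  simp only [norm_sq_eq_dotProduct, WithLp.ofLp_sub, WithLp.ofLp_add, map_add,
    ofLp_toEuclideanLin, hx', add_sub_cancel_left]
  have hAp : ∀ u : Fin k → ℝ, (A *ᵥ u) ⬝ᵥ y = u ⬝ᵥ p := by
    intro u; rw [hp, dotProduct_mulVec u, vecMul_transpose]
  have e1 : A *ᵥ p + s2 • y - (A *ᵥ p + A *ᵥ h.ofLp) = s2 • y - A *ᵥ h.ofLp := by abel
  rw [e1]
  simp only [sub_dotProduct, dotProduct_sub, smul_dotProduct, dotProduct_smul, add_dotProduct,
    dotProduct_add, smul_eq_mul, hAp]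
  rw [dotProduct_comm y (A *ᵥ h.ofLp), hAp, dotProduct_comm p h.ofLp]
  field_simp
  ring

lemma quadForm_le (hs : 0 < s2) (x : EuclideanSpace ℝ (Fin N)) (g : EuclideanSpace ℝ (Fin k)) :
    x.ofLp ⬝ᵥ ((A * Aᵀ + s2 • (1 : Matrix (Fin N) (Fin N) ℝ))⁻¹ *ᵥ x.ofLp)
      ≤ ‖x - Matrix.toEuclideanLin A g‖ ^ 2 / s2 + ‖g‖ ^ 2 := by
  rw [quadForm_eq A hs x g]
  exact le_add_of_nonneg_right (by positivity)

lemma exists_quadForm_eq (hs : 0 < s2) (x : EuclideanSpace ℝ (Fin N)) :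
    ∃ g : EuclideanSpace ℝ (Fin k),
      x.ofLp ⬝ᵥ ((A * Aᵀ + s2 • (1 : Matrix (Fin N) (Fin N) ℝ))⁻¹ *ᵥ x.ofLp)
        = ‖x - Matrix.toEuclideanLin A g‖ ^ 2 / s2 + ‖g‖ ^ 2 := by
  refine ⟨WithLp.toLp 2
    (Aᵀ *ᵥ ((A * Aᵀ + s2 • (1 : Matrix (Fin N) (Fin N) ℝ))⁻¹ *ᵥ x.ofLp)), ?_⟩
  rw [quadForm_eq A hs x]
  simp

end

/-- The annihilator form is at most every squared residual: `u' M_B u ≤ ‖u - B g‖²`. -/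
lemma dotProduct_annihilator_le {N k : ℕ} (B : Matrix (Fin N) (Fin k) ℝ)
    (hB : ∀ v : EuclideanSpace ℝ (Fin k), Matrix.toEuclideanLin B v = 0 → v = 0)
    (u : EuclideanSpace ℝ (Fin N)) (g : EuclideanSpace ℝ (Fin k)) :
    u.ofLp ⬝ᵥ (annihilator B *ᵥ u.ofLp) ≤ ‖u - Matrix.toEuclideanLin B g‖ ^ 2 := by
  have hpd : (Bᵀ * B).PosDef := by
    have := Matrix.PosDef.conjTranspose_mul_self B (by
      intro v w hvw
      have : Matrix.toEuclideanLin B (WithLp.toLp 2 (v - w)) = 0 := by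
        apply WithLp.ofLp_injective
        rw [ofLp_toEuclideanLin, WithLp.ofLp_toLp, mulVec_sub, show B *ᵥ v = B *ᵥ w from hvw,
          sub_self, WithLp.ofLp_zero]
      have := hB _ this
      have h2 := congrArg WithLp.ofLp this
      simpa [sub_eq_zero] using h2)
    simpa using this
  have hu : IsUnit (Bᵀ * B).det := (Matrix.isUnit_iff_isUnit_det _).1 hpd.isUnit
  -- least squares: the residual of `u` at the coefficient `p` is orthogonal to the columns of `B`
  set p := (Bᵀ * B)⁻¹ *ᵥ (Bᵀ *ᵥ u.ofLp) with hp
  have hM : annihilator B *ᵥ u.ofLp = u.ofLp - B *ᵥ p := by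
    rw [annihilator, sub_mulVec, one_mulVec, ← mulVec_mulVec, ← mulVec_mulVec]
  have hn : Bᵀ *ᵥ (u.ofLp - B *ᵥ p) = 0 := by
    rw [mulVec_sub, hp, mulVec_mulVec, mulVec_mulVec, Matrix.mul_nonsing_inv _ hu, one_mulVec,
      sub_self]
  have horth : ∀ w : Fin k → ℝ, (B *ᵥ w) ⬝ᵥ (u.ofLp - B *ᵥ p) = 0 := by
    intro w
    rw [← vecMul_transpose, ← dotProduct_mulVec, hn, dotProduct_zero]
  rw [hM, norm_sq_eq_dotProduct, WithLp.ofLp_sub, ofLp_toEuclideanLin]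
  set r := u.ofLp - B *ᵥ p with hr
  have e1 : u.ofLp = r + B *ᵥ p := by rw [hr]; abel
  have e2 : u.ofLp - B *ᵥ g.ofLp = r + B *ᵥ (p - g.ofLp) := by rw [e1, mulVec_sub]; abel
  rw [e2]
  nth_rewrite 1 [e1]
  rw [add_dotProduct, horth, add_dotProduct, dotProduct_add, dotProduct_add, horth,
    dotProduct_comm r (B *ᵥ (p - g.ofLp)), horth]
  have : 0 ≤ (B *ᵥ (p - g.ofLp)) ⬝ᵥ (B *ᵥ (p - g.ofLp)) :=
    Finset.sum_nonneg fun j _ => mul_self_nonneg _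
  linarith

/-! ### Geometry of approximate containment of subspaces -/

section Geometry

variable {E F G : Type*} [NormedAddCommGroup E] [InnerProductSpace ℝ E]
  [NormedAddCommGroup F] [InnerProductSpace ℝ F] [NormedAddCommGroup G] [InnerProductSpace ℝ G]

/-- The orthogonal projection onto the range of `B`, restricted to the range of `A`. -/
def rangeProj [FiniteDimensional ℝ G]
    (A : F →ₗ[ℝ] E) (B : G →ₗ[ℝ] E) : LinearMap.range A →ₗ[ℝ] LinearMap.range B :=
  ((LinearMap.range B).orthogonalProjectionOnto : E →ₗ[ℝ] LinearMap.range B) ∘ₗ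
    (LinearMap.range A).subtype

lemma norm_sub_orthogonalProjection_le [FiniteDimensional ℝ G]
    {B : G →ₗ[ℝ] E} (v : E) (g : G) :
    ‖v - ((LinearMap.range B).orthogonalProjectionOnto v : E)‖ ≤ ‖v - B g‖ := by
  have h := (LinearMap.range B).starProjection_minimal (y := v)
  rw [Submodule.starProjection_apply] at h
  rw [h]
  exact ciInf_le ⟨0, by rintro _ ⟨x, rfl⟩; exact norm_nonneg _⟩
    (⟨B g, LinearMap.mem_range_self B g⟩ : LinearMap.range B)

lemma norm_sub_rangeProj_le [FiniteDimensional ℝ G]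
    {A : F →ₗ[ℝ] E} {B : G →ₗ[ℝ] E} {ε : ℝ}
    (h : ∀ f, ∃ g, ‖A f - B g‖ ≤ ε * ‖A f‖) (v : LinearMap.range A) :
    ‖(v : E) - rangeProj A B v‖ ≤ ε * ‖(v : E)‖ := by
  obtain ⟨_, f, rfl⟩ := v
  obtain ⟨g, hg⟩ := h f
  exact (norm_sub_orthogonalProjection_le _ g).trans hg

lemma rangeProj_injective [FiniteDimensional ℝ G]
    {A : F →ₗ[ℝ] E} {B : G →ₗ[ℝ] E} {ε : ℝ} (hε : ε < 1)
    (h : ∀ f, ∃ g, ‖A f - B g‖ ≤ ε * ‖A f‖) : Function.Injective (rangeProj A B) := by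
  rw [← LinearMap.ker_eq_bot, LinearMap.ker_eq_bot']
  intro v hv
  have := norm_sub_rangeProj_le h v
  rw [hv, ZeroMemClass.coe_zero, sub_zero] at this
  have h0 : ‖(v : E)‖ = 0 := by nlinarith [norm_nonneg (v : E)]
  exact Subtype.ext (norm_eq_zero.1 h0)

lemma injective_of_le_norm {A : F →ₗ[ℝ] E} {c : ℝ} (hc : 0 < c) (h : ∀ f, c * ‖f‖ ≤ ‖A f‖) :
    Function.Injective A := by
  rw [← LinearMap.ker_eq_bot, LinearMap.ker_eq_bot']
  intro f hf
  have h1 := h f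
  rw [hf, norm_zero] at h1
  exact norm_le_zero_iff.1 (nonpos_of_mul_nonpos_right h1 hc)

lemma finrank_le_of_approx [FiniteDimensional ℝ F] [FiniteDimensional ℝ G]
    {A : F →ₗ[ℝ] E} {B : G →ₗ[ℝ] E} {ε : ℝ} (hε : ε < 1)
    (hA : Function.Injective A) (h : ∀ f, ∃ g, ‖A f - B g‖ ≤ ε * ‖A f‖) :
    Module.finrank ℝ F ≤ Module.finrank ℝ G := by
  rw [← LinearMap.finrank_range_of_inj hA]
  exact (LinearMap.finrank_le_finrank_of_injective (rangeProj_injective hε h)).trans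
    (LinearMap.finrank_range_le B)

/-- If the range of `A` is approximately contained in the range of `B`, and the latter has no larger
dimension, then the range of `B` is approximately contained in the range of `A`. -/
lemma exists_approx_of_finrank_le [FiniteDimensional ℝ F] [FiniteDimensional ℝ G]
    {A : F →ₗ[ℝ] E} {B : G →ₗ[ℝ] E} {ε : ℝ} (hε0 : 0 ≤ ε)
    (hε : ε ≤ 1 / 2) (hA : Function.Injective A) (h : ∀ f, ∃ g, ‖A f - B g‖ ≤ ε * ‖A f‖)
    (hd : Module.finrank ℝ G ≤ Module.finrank ℝ F) (g : G) :
    ∃ f, ‖B g - A f‖ ≤ 2 * ε * ‖B g‖ := by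
  have hinj := rangeProj_injective (A := A) (B := B) (by linarith) h
  have hsurj : Function.Surjective (rangeProj A B) := by
    refine (LinearMap.injective_iff_surjective_of_finrank_eq_finrank ?_).1 hinj
    refine le_antisymm (LinearMap.finrank_le_finrank_of_injective hinj) ?_
    rw [LinearMap.finrank_range_of_inj hA]
    exact (LinearMap.finrank_range_le B).trans hd
  obtain ⟨v, hv⟩ := hsurj ⟨B g, LinearMap.mem_range_self B g⟩
  have h1 := norm_sub_rangeProj_le h v
  rw [hv] at h1
  obtain ⟨_, f, rfl⟩ := v
  refine ⟨f, ?_⟩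
  simp only at h1
  rw [norm_sub_rev]
  have h2 : ‖A f‖ ≤ ‖A f - B g‖ + ‖B g‖ := by
    simpa using norm_add_le (A f - B g) (B g)
  have h3 : ‖A f‖ ≤ 2 * ‖B g‖ := by nlinarith [norm_nonneg (A f)]
  nlinarith

/-- If the second moments of a family are bounded below, every vector is a combination of the family
with small coefficients. -/
lemma exists_coeff [FiniteDimensional ℝ F]
    {ι : Type*} (S : Finset ι) (v : ι → F) {κ : ℝ} (hκ : 0 < κ)
    (h : ∀ w, κ * ‖w‖ ^ 2 ≤ ∑ s ∈ S, (inner ℝ (v s) w) ^ 2) (f : F) :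
    ∃ a : ι → ℝ, f = ∑ s ∈ S, a s • v s ∧ κ * ∑ s ∈ S, a s ^ 2 ≤ ‖f‖ ^ 2 := by
  let Φ : F →ₗ[ℝ] F := ∑ s ∈ S, LinearMap.toSpanSingleton ℝ F (v s) ∘ₗ innerₛₗ ℝ (v s)
  have hΦ : ∀ w, Φ w = ∑ s ∈ S, inner ℝ (v s) w • v s := by
    intro w; simp [Φ]
  have hin : ∀ w, inner ℝ (Φ w) w = ∑ s ∈ S, (inner ℝ (v s) w) ^ 2 := by
    intro w
    rw [hΦ, sum_inner]
    exact Finset.sum_congr rfl fun s _ => by rw [real_inner_smul_left, sq]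
  have hinj : Function.Injective Φ := by
    rw [← LinearMap.ker_eq_bot, LinearMap.ker_eq_bot']
    intro w hw
    have h1 := h w
    rw [← hin, hw, inner_zero_left] at h1
    have : ‖w‖ ^ 2 = 0 := le_antisymm (nonpos_of_mul_nonpos_right h1 hκ) (sq_nonneg _)
    exact norm_eq_zero.1 (pow_eq_zero_iff two_ne_zero |>.1 this)
  obtain ⟨u, hu⟩ := (LinearMap.injective_iff_surjective.1 hinj) f
  refine ⟨fun s => inner ℝ (v s) u, by rw [← hu, hΦ], ?_⟩
  have h1 := h u
  rw [← hin, hu] at h1 ⊢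
  have h2 : inner ℝ f u ≤ ‖f‖ * ‖u‖ := real_inner_le_norm f u
  have h3 : κ * ‖u‖ ≤ ‖f‖ := by
    rcases (norm_nonneg u).eq_or_lt with h0 | h0
    · rw [← h0, mul_zero]; exact norm_nonneg _
    · nlinarith
  nlinarith [norm_nonneg f]

lemma norm_sum_smul_sq_le {ι : Type*} (S : Finset ι) (a : ι → ℝ) (w : ι → E) :
    ‖∑ s ∈ S, a s • w s‖ ^ 2 ≤ (∑ s ∈ S, a s ^ 2) * ∑ s ∈ S, ‖w s‖ ^ 2 := by
  have h1 : ‖∑ s ∈ S, a s • w s‖ ≤ ∑ s ∈ S, |a s| * ‖w s‖ :=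
    (norm_sum_le _ _).trans (Finset.sum_le_sum fun s _ => by rw [norm_smul, Real.norm_eq_abs])
  calc ‖∑ s ∈ S, a s • w s‖ ^ 2 ≤ (∑ s ∈ S, |a s| * ‖w s‖) ^ 2 :=
        pow_le_pow_left₀ (norm_nonneg _) h1 2
    _ ≤ (∑ s ∈ S, |a s| ^ 2) * ∑ s ∈ S, ‖w s‖ ^ 2 := Finset.sum_mul_sq_le_sq_mul_sq _ _ _
    _ = _ := by simp

/-- A good average fit `A v_s ≈ B g_s` along a nondegenerate family `v_s` extends by linearity to a
good fit of `A f` for every `f`. -/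
lemma exists_fit_of_average [FiniteDimensional ℝ F]
    {ι : Type*} (A : F →ₗ[ℝ] E) (B : G →ₗ[ℝ] E) (S : Finset ι) (v : ι → F)
    (g : ι → G) {κ b : ℝ} (hκ : 0 < κ)
    (h : ∀ w, κ * ‖w‖ ^ 2 ≤ ∑ s ∈ S, (inner ℝ (v s) w) ^ 2)
    (hg : ∑ s ∈ S, ‖g s‖ ^ 2 ≤ κ * b) (hfit : ∑ s ∈ S, ‖A (v s) - B (g s)‖ ^ 2 ≤ κ * b) (f : F) :
    ∃ g', ‖g'‖ ^ 2 ≤ b * ‖f‖ ^ 2 ∧ ‖A f - B g'‖ ^ 2 ≤ b * ‖f‖ ^ 2 := by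
  obtain ⟨a, rfl, ha⟩ := exists_coeff S v hκ h f
  set f := ∑ s ∈ S, a s • v s with hf
  have hsq : 0 ≤ ∑ s ∈ S, a s ^ 2 := Finset.sum_nonneg fun _ _ => sq_nonneg _
  have hb : 0 ≤ b := nonneg_of_mul_nonneg_right
    ((Finset.sum_nonneg fun _ _ => sq_nonneg _).trans hg) hκ
  have key : ∀ x : ℝ, x ≤ κ * b → (∑ s ∈ S, a s ^ 2) * x ≤ b * ‖f‖ ^ 2 := by
    intro x hx
    calc (∑ s ∈ S, a s ^ 2) * x ≤ (∑ s ∈ S, a s ^ 2) * (κ * b) :=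
          mul_le_mul_of_nonneg_left hx hsq
      _ = b * (κ * ∑ s ∈ S, a s ^ 2) := by ring
      _ ≤ _ := mul_le_mul_of_nonneg_left ha hb
  refine ⟨∑ s ∈ S, a s • g s, (norm_sum_smul_sq_le _ _ _).trans (key _ hg), ?_⟩
  have : A f - B (∑ s ∈ S, a s • g s) = ∑ s ∈ S, a s • (A (v s) - B (g s)) := by
    simp [hf, map_sum, smul_sub, Finset.sum_sub_distrib]
  rw [this]
  exact (norm_sum_smul_sq_le _ _ _).trans (key _ hfit)

lemma sum_norm_sq_orthogonalProjection_le [FiniteDimensional ℝ E]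
    {ι : Type*} (S : Finset ι) (W : Submodule ℝ E) (e : ι → E)
    {b : ℝ} (h : ∀ v : E, ∑ t ∈ S, (inner ℝ v (e t)) ^ 2 ≤ b * ‖v‖ ^ 2) :
    ∑ t ∈ S, ‖W.orthogonalProjectionOnto (e t)‖ ^ 2 ≤ Module.finrank ℝ W * b := by
  have h1 : ∀ t, ‖W.orthogonalProjectionOnto (e t)‖ ^ 2
      = ∑ a, (inner ℝ (stdOrthonormalBasis ℝ W a : E) (e t)) ^ 2 := by
    intro t
    rw [← (stdOrthonormalBasis ℝ W).sum_sq_norm_inner_right]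
    refine Finset.sum_congr rfl fun a _ => ?_
    rw [← Submodule.inner_orthogonalProjectionOnto_eq_of_mem_left, Real.norm_eq_abs, sq_abs]
  simp_rw [h1]
  rw [Finset.sum_comm]
  calc _ ≤ ∑ a : Fin (Module.finrank ℝ W), b := by
        refine Finset.sum_le_sum fun a _ => (h _).trans ?_
        have : ‖(stdOrthonormalBasis ℝ W a : E)‖ = 1 := (stdOrthonormalBasis ℝ W).orthonormal.1 a
        rw [this]; simp
    _ = _ := by simp

/-- Adding a vector `d` of `W` to `e` increases the squared norm by at least `‖d‖² / 2`, up to the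
component of `e` along `W`. -/
lemma norm_add_sq_ge [FiniteDimensional ℝ E]
    (W : Submodule ℝ E) (e : E) {d : E} (hd : d ∈ W) :
    ‖e‖ ^ 2 + ‖d‖ ^ 2 / 2 - 2 * ‖W.orthogonalProjectionOnto e‖ ^ 2 ≤ ‖d + e‖ ^ 2 := by
  have h1 : inner ℝ d e = inner ℝ (⟨d, hd⟩ : W) (W.orthogonalProjectionOnto e) :=
    (Submodule.inner_orthogonalProjectionOnto_eq_of_mem_left ⟨d, hd⟩ e).symm
  have h2 : |inner ℝ d e| ≤ ‖d‖ * ‖W.orthogonalProjectionOnto e‖ := by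
    rw [h1]; exact abs_real_inner_le_norm _ _
  have h3 := (abs_le.1 h2).1
  rw [norm_add_sq_real]
  nlinarith [sq_nonneg (‖d‖ - 2 * ‖W.orthogonalProjectionOnto e‖)]

/-- The fit by a wrong regime. Here `a` is the common component of the observation `a + e`, `w` a
fitted value, and `v` a point of the wrong true loading space close to `w`; `s` stands for `√N`. -/
lemma norm_sq_ge_of_separated {a e w v : E} {s c K ε R X Y K' τ : ℝ} (hs : 0 < s)
    (hc : 0 < c) (hK : 0 ≤ K) (hK' : 0 ≤ K') (hε0 : 0 ≤ ε) (hR : 1 ≤ R) (hX0 : 0 ≤ X) (hY : 1 ≤ Y)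
    (hw : ‖w - v‖ ≤ ε * ‖w‖) (hsep : c * s ≤ ‖a - v‖) (ha : ‖a‖ ≤ K * s * R)
    (hea : |inner ℝ e a| ≤ s * X * R) (hev : |inner ℝ e v| ≤ K' * X * ‖v‖) (he : ‖e‖ ≤ s * Y)
    (hεYR : ε * Y * R ≤ τ) (hXR : X * R ≤ τ * s)
    (hτ : τ ≤ 1 / 2) (hτ1 : 2 * τ * (c + K) ≤ c / 2)
    (hτ2 : τ * (2 + 2 * K' * (c + K) + 4 * (c + K)) ≤ c ^ 2 / 8) :
    ‖e‖ ^ 2 + c ^ 2 / 8 * s ^ 2 ≤ ‖a + e - w‖ ^ 2 := by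
  set U := ‖a - v‖ with hU
  have hU0 : 0 ≤ U := norm_nonneg _
  have hεR : ε * R ≤ τ := by
    refine le_trans ?_ hεYR
    nlinarith [mul_nonneg hε0 (by linarith : (0:ℝ) ≤ R)]
  have hε : ε ≤ τ := by nlinarith
  have hX : X ≤ τ * s := by nlinarith
  have hεY : ε * Y ≤ τ := by
    refine le_trans ?_ hεYR
    nlinarith [mul_nonneg hε0 (by linarith : (0:ℝ) ≤ Y)]
  have hτ0 : 0 ≤ τ := hε0.trans hε
  have hcK : 0 ≤ c + K := by linarith
  -- work in units of `M = U / c`, which dominates `s`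
  obtain ⟨M, hM⟩ : ∃ M, U = c * M := ⟨U / c, by field_simp⟩
  have hMs : s ≤ M := by rw [hM] at hsep; exact le_of_mul_le_mul_left hsep hc
  have hM0 : 0 < M := hs.trans_le hMs
  have hv : ‖v‖ ≤ U + K * s * R := by
    have : ‖v‖ ≤ ‖a - v‖ + ‖a‖ := by
      have := norm_sub_le a (a - v)
      rw [sub_sub_cancel] at this; linarith
    linarith
  have hKsR : 0 ≤ K * s * R := by positivity
  have hwv : ‖w‖ ≤ 2 * ‖v‖ := by
    have : ‖w‖ ≤ ‖w - v‖ + ‖v‖ := by simpa using norm_add_le (w - v) v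
    nlinarith [norm_nonneg w]
  have hb : ‖w - v‖ ≤ 2 * ε * (U + K * s * R) := by nlinarith [norm_nonneg v]
  have hb1 : ‖w - v‖ ≤ 2 * τ * (c + K) * M := by
    have e1 : ε * U ≤ τ * (c * M) := by
      rw [hM]; exact mul_le_mul_of_nonneg_right hε (by positivity)
    have e2 : ε * (K * s * R) ≤ τ * (K * M) := by
      calc ε * (K * s * R) = (ε * R) * (K * s) := by ring
        _ ≤ τ * (K * M) := mul_le_mul hεR (by gcongr) (by positivity) hτ0
    linarith
  have hb2 : ‖e‖ * ‖w - v‖ ≤ 2 * τ * (c + K) * M ^ 2 := by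
    have e1 : (ε * Y) * U ≤ τ * (c * M) := by
      rw [hM]; exact mul_le_mul_of_nonneg_right hεY (by positivity)
    have e2 : (ε * Y * R) * (K * s) ≤ τ * (K * M) :=
      mul_le_mul hεYR (by gcongr) (by positivity) hτ0
    calc ‖e‖ * ‖w - v‖ ≤ (s * Y) * (2 * ε * (U + K * s * R)) :=
          mul_le_mul he hb (norm_nonneg _) (by positivity)
      _ = 2 * s * ((ε * Y) * U + (ε * Y * R) * (K * s)) := by ring
      _ ≤ 2 * M * (τ * (c * M) + τ * (K * M)) :=
          mul_le_mul (by linarith) (add_le_add e1 e2) (by positivity) (by positivity)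
      _ = _ := by ring
  have hev2 : K' * X * ‖v‖ ≤ τ * (K' * (c + K)) * M ^ 2 := by
    have hτsM : τ * s ≤ τ * M := mul_le_mul_of_nonneg_left hMs hτ0
    have e1 : X * U ≤ (τ * M) * (c * M) := by
      rw [hM]; exact mul_le_mul_of_nonneg_right (hX.trans hτsM) (by positivity)
    have e2 : (X * R) * (K * s) ≤ (τ * M) * (K * M) :=
      mul_le_mul (hXR.trans hτsM) (by gcongr) (by positivity) (by positivity)
    calc K' * X * ‖v‖ ≤ K' * X * (U + K * s * R) :=
          mul_le_mul_of_nonneg_left hv (by positivity)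
      _ = K' * (X * U + (X * R) * (K * s)) := by ring
      _ ≤ K' * ((τ * M) * (c * M) + (τ * M) * (K * M)) :=
          mul_le_mul_of_nonneg_left (add_le_add e1 e2) hK'
      _ = _ := by ring
  have hea2 : s * X * R ≤ τ * M ^ 2 := by
    calc s * X * R = s * (X * R) := by ring
      _ ≤ M * (τ * M) := mul_le_mul hMs
          (hXR.trans (mul_le_mul_of_nonneg_left hMs hτ0)) (by positivity) hM0.le
      _ = _ := by ring
  have hub : c / 2 * M ≤ ‖(a - v) - (w - v)‖ := by
    have h1 : U - ‖w - v‖ ≤ ‖(a - v) - (w - v)‖ := norm_sub_norm_le _ _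
    have h2 : 2 * τ * (c + K) * M ≤ c / 2 * M := mul_le_mul_of_nonneg_right hτ1 hM0.le
    linarith
  have hub2 : c ^ 2 / 4 * M ^ 2 ≤ ‖(a - v) - (w - v)‖ ^ 2 := by
    calc c ^ 2 / 4 * M ^ 2 = (c / 2 * M) ^ 2 := by ring
      _ ≤ _ := by gcongr
  have hdec : ‖a + e - w‖ ^ 2 = ‖e‖ ^ 2 + ‖(a - v) - (w - v)‖ ^ 2 + 2 * inner ℝ e a
      - 2 * inner ℝ e v - 2 * inner ℝ e (w - v) := by
    have : a + e - w = e + ((a - v) - (w - v)) := by abel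
    rw [this, norm_add_sq_real, inner_sub_right, inner_sub_right]; ring
  have hin : inner ℝ e (w - v) ≤ ‖e‖ * ‖w - v‖ := real_inner_le_norm _ _
  have h1 := (abs_le.1 hea).1
  have h2 := (abs_le.1 hev).2
  have h3 := mul_le_mul_of_nonneg_right hτ2 (sq_nonneg M)
  have h4 : c ^ 2 / 8 * s ^ 2 ≤ c ^ 2 / 8 * M ^ 2 := by gcongr
  rw [hdec]
  linarith

/-- The fit by the right regime. -/
lemma norm_sq_le_of_close {a e w : E} {s d R Y τ : ℝ} (hs : 0 ≤ s) (hd : 0 ≤ d) (hR : 1 ≤ R)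
    (hY : 1 ≤ Y) (hτ1 : τ ≤ 1) (haw : ‖a - w‖ ≤ s * d * R) (he : ‖e‖ ≤ s * Y)
    (hdYR : d * Y * R ≤ τ) : ‖a + e - w‖ ^ 2 ≤ ‖e‖ ^ 2 + 3 * τ * s ^ 2 := by
  have hdR : d * R ≤ τ := by
    refine le_trans ?_ hdYR
    nlinarith [mul_nonneg hd (by linarith : (0:ℝ) ≤ R)]
  have hτ0 : 0 ≤ τ := le_trans (by positivity) hdR
  have h0 : ‖a - w‖ ≤ s * τ := haw.trans (by rw [mul_assoc]; gcongr)
  have h1 : ‖e‖ * ‖a - w‖ ≤ τ * s ^ 2 := by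
    calc ‖e‖ * ‖a - w‖ ≤ (s * Y) * (s * d * R) := by gcongr
      _ = (d * Y * R) * s ^ 2 := by ring
      _ ≤ _ := by gcongr
  have h2 : ‖a - w‖ ^ 2 ≤ τ * s ^ 2 := by
    calc ‖a - w‖ ^ 2 ≤ (s * τ) ^ 2 := by gcongr
      _ = τ * τ * s ^ 2 := by ring
      _ ≤ 1 * τ * s ^ 2 := by gcongr
      _ = _ := by ring
  have h3 : a + e - w = e + (a - w) := by abel
  have h4 : inner ℝ e (a - w) ≤ ‖e‖ * ‖a - w‖ := real_inner_le_norm _ _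
  rw [h3, norm_add_sq_real]
  linarith

end Geometry

/-! ### Matching of regimes -/

/-- A self-map of a finite type that never decreases the rank `r`, and for which two points with the
same image have strictly smaller ranks than their image, is a rank preserving bijection. -/
lemma bijective_of_rank {J : Type*} [Finite J] {r : J → ℕ} {σ : J → J} (h1 : ∀ j, r j ≤ r (σ j))
    (h2 : ∀ j k, j ≠ k → σ j = σ k → r j < r (σ j)) :
    Function.Bijective σ ∧ ∀ j, r (σ j) = r j := by
  have key : ∀ j, r (σ j) = r j := by
    by_contra! hcon
    -- take a point whose rank increases, with the largest possible rank of its image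
    obtain ⟨j0, hj0, hmax⟩ := Set.Finite.exists_maximalFor (fun j => r (σ j)) {j | r (σ j) ≠ r j}
      (Set.toFinite _) hcon
    set d := r (σ j0)
    have hS : ∀ j, d ≤ r j → r (σ j) = r j := by
      intro j hj
      by_contra hne
      have hle : d ≤ r (σ j) := hj.trans (h1 j)
      have := hmax (j := j) hne hle
      exact hne (le_antisymm (this.trans hj) (h1 j))
    let f : {j // d ≤ r j} → {j // d ≤ r j} := fun j => ⟨σ j, by rw [hS _ j.2]; exact j.2⟩
    have hf : Function.Injective f := by
      intro x y hxy
      by_contra hne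
      have h3 := h2 x y (fun h => hne (Subtype.ext h)) (congrArg Subtype.val hxy)
      rw [hS _ x.2] at h3
      exact lt_irrefl _ h3
    obtain ⟨x, hx⟩ := (Finite.injective_iff_surjective.1 hf) ⟨σ j0, le_refl _⟩
    have hx' : σ x = σ j0 := congrArg Subtype.val hx
    have hne : (x : J) ≠ j0 := by
      rintro h
      exact hj0 (h ▸ hS _ x.2)
    have h3 := h2 x j0 hne hx'
    rw [hS _ x.2] at h3
    exact lt_irrefl _ h3
  refine ⟨Finite.injective_iff_bijective.1 fun j k hjk => ?_, key⟩
  by_contra hne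
  have := h2 j k hne hjk
  rw [key] at this
  exact lt_irrefl _ this

/-! ### Posterior weights -/

/-- If the density of one component dominates the others by the factor `δ⁻¹`, Bayes' formula gives
weights within `O(δ)` of the indicator of this component. -/
lemma abs_posterior_sub_le {J : Type*} [Fintype J] [DecidableEq J] {q D : J → ℝ} {j : J} {c δ : ℝ}
    (hc : 0 < c) (hq : ∀ k, 0 < q k) (hq1 : ∑ k, q k = 1) (hD : ∀ k, 0 < D k)
    (hqj : c ≤ q j) (h : ∀ l, l ≠ j → D l ≤ δ * D j) (hδ : 0 ≤ δ) (l : J) :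
    |q l * D l / ∑ k, q k * D k - if j = l then 1 else 0| ≤ c⁻¹ * δ := by
  have hpos : ∀ k, 0 < q k * D k := fun k => mul_pos (hq k) (hD k)
  have hsum : q j * D j ≤ ∑ k, q k * D k :=
    Finset.single_le_sum (f := fun k => q k * D k) (fun k _ => (hpos k).le) (Finset.mem_univ j)
  have hS : 0 < ∑ k, q k * D k := (hpos j).trans_le hsum
  have hcD : c * D j ≤ ∑ k, q k * D k := (mul_le_mul_of_nonneg_right hqj (hD j).le).trans hsum
  have key : ∀ x, x ≤ δ * D j → x / ∑ k, q k * D k ≤ c⁻¹ * δ := by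
    intro x hx
    rw [div_le_iff₀ hS]
    calc x ≤ δ * D j := hx
      _ = c⁻¹ * δ * (c * D j) := by field_simp
      _ ≤ _ := by gcongr
  by_cases hl : j = l
  · subst hl
    rw [if_pos rfl, abs_sub_comm, abs_of_nonneg (by rw [sub_nonneg, div_le_one hS]; exact hsum)]
    have : 1 - q j * D j / ∑ k, q k * D k
        = (∑ k ∈ Finset.univ.erase j, q k * D k) / ∑ k, q k * D k := by
      rw [← Finset.add_sum_erase _ _ (Finset.mem_univ j)] at hS ⊢
      field_simp
      ring
    rw [this]
    apply key
    calc ∑ k ∈ Finset.univ.erase j, q k * D k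
        ≤ ∑ k ∈ Finset.univ.erase j, q k * (δ * D j) := by
          refine Finset.sum_le_sum fun k hk => ?_
          exact mul_le_mul_of_nonneg_left (h k (Finset.ne_of_mem_erase hk)) (hq k).le
      _ = (∑ k ∈ Finset.univ.erase j, q k) * (δ * D j) := by rw [Finset.sum_mul]
      _ ≤ 1 * (δ * D j) := by
          refine mul_le_mul_of_nonneg_right ?_ (mul_nonneg hδ (hD j).le)
          rw [← hq1]
          exact Finset.sum_le_sum_of_subset_of_nonneg (Finset.erase_subset _ _)
            fun k _ _ => (hq k).le
      _ = _ := one_mul _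
  · rw [if_neg hl, sub_zero, abs_of_pos (div_pos (hpos l) hS)]
    apply key
    have hql : q l ≤ 1 := by
      rw [← hq1]
      exact Finset.single_le_sum (fun k _ => (hq k).le) (Finset.mem_univ l)
    calc q l * D l ≤ 1 * D l := by gcongr; exact (hD l).le
      _ ≤ _ := by rw [one_mul]; exact h l (Ne.symm hl)

namespace Model

variable {Ω : Type*} [MeasurableSpace Ω] (m : Model Ω)

/-! ### Fit of the estimated loadings for one sample -/

/-- The errors of the first `N` units at time `t`, as a Euclidean vector. -/
def errVec (N t : ℕ) (ω : Ω) : EuclideanSpace ℝ (Fin N) :=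
  WithLp.toLp 2 fun i => m.e i t ω

/-- The common component `Λ_j f_t`, `j = z_t`, of the observation at time `t`. -/
def common (N t : ℕ) (ω : Ω) : EuclideanSpace ℝ (Fin N) :=
  Matrix.toEuclideanLin (m.loading N (m.z t ω)) (m.F t ω (m.z t ω))

lemma toLp_obs (N t : ℕ) (ω : Ω) :
    WithLp.toLp 2 (m.obs N t ω) = m.common N t ω + m.errVec N t ω := rfl

lemma common_eq {N t : ℕ} {ω : Ω} {j : Fin m.J} (h : m.z t ω = j) :
    m.common N t ω = Matrix.toEuclideanLin (m.loading N j) (m.F t ω j) := by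
  subst h; rfl

/-- The estimated regime `k` reproduces the loadings of the true regime `j` up to the relative
error `d`: every `Λ_j f` is within `√N d ‖f‖` of some `Λ̂_k g` with small `g`, and the
log-determinant of regime `k` is at most `N d²`. -/
def Fits {N : ℕ} (L : m.Loadings N) (s2 d : ℝ) (j k : Fin m.J) : Prop :=
  logDetExcess (L k) s2 ≤ N * d ^ 2 ∧
  ∀ f : EuclideanSpace ℝ (Fin (m.r j)), ∃ g : EuclideanSpace ℝ (Fin (m.r k)),
    ‖g‖ ≤ √N * d * ‖f‖ ∧
    ‖Matrix.toEuclideanLin (m.loading N j) f - Matrix.toEuclideanLin (L k) g‖ ≤ √N * d * ‖f‖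

variable {m}

/-- What maximization of the likelihood gives: if every time `t` is assigned to the estimated regime
`k t` that explains it best, the total cost is at most the one of the true loadings. -/
lemma exists_assignment {N T : ℕ} {ω : Ω} {L : m.Loadings N} {s2 : ℝ} {q : Fin m.J → ℝ}
    (hmax : m.logLik N T ω (m.loading N) s2 q ≤ m.logLik N T ω L s2 q)
    (hs : 0 < s2) (hq : ∀ j, 0 < q j) (hq1 : ∑ j, q j = 1) {c ℓ : ℝ} (hc : 0 < c)
    (hcq : ∀ j, c ≤ q j) (hℓ : ∀ j, logDetExcess (m.loading N j) s2 ≤ ℓ) :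
    ∃ (k : ℕ → Fin m.J) (g : ℕ → (k : Fin m.J) → EuclideanSpace ℝ (Fin (m.r k))),
      ∑ t ∈ Finset.range T, (logDetExcess (L (k t)) s2 +
          (‖m.common N t ω + m.errVec N t ω - Matrix.toEuclideanLin (L (k t)) (g t (k t))‖ ^ 2 / s2
            + ‖g t (k t)‖ ^ 2))
        ≤ ∑ t ∈ Finset.range T, (ℓ + (‖m.errVec N t ω‖ ^ 2 / s2 + ‖m.F t ω (m.z t ω)‖ ^ 2)
            - 2 * Real.log c) := by
  have hk : ∀ t, ∃ k, ∀ l, cost (L k) s2 (m.obs N t ω) ≤ cost (L l) s2 (m.obs N t ω) := by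
    intro t
    have : Nonempty (Fin m.J) := ⟨m.z t ω⟩
    exact Finite.exists_min _
  choose k hk using hk
  have hg : ∀ (t : ℕ) (l : Fin m.J), _ := fun t l =>
    exists_quadForm_eq (L l) hs (WithLp.toLp 2 (m.obs N t ω))
  choose g hg using hg
  refine ⟨k, g, ?_⟩
  set κ : ℝ := (2 * Real.pi) ^ (-(N : ℝ) / 2) * s2 ^ (-(N : ℝ) / 2) with hκ
  have hκ0 : 0 < κ := by positivity
  -- a mixture density is at most its largest component, and at least any one component
  have upper : ∀ t, Real.log (∑ j, q j * density (L j) s2 (m.obs N t ω))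
      ≤ Real.log κ - 1 / 2 * cost (L (k t)) s2 (m.obs N t ω) := by
    intro t
    have h1 : ∑ j, q j * density (L j) s2 (m.obs N t ω)
        ≤ κ * Real.exp (-(1 / 2) * cost (L (k t)) s2 (m.obs N t ω)) := by
      calc _ ≤ ∑ j, q j * (κ * Real.exp (-(1 / 2) * cost (L (k t)) s2 (m.obs N t ω))) := by
            refine Finset.sum_le_sum fun j _ => mul_le_mul_of_nonneg_left ?_ (hq j).le
            rw [density_eq _ hs]
            refine mul_le_mul_of_nonneg_left (Real.exp_le_exp.2 ?_) hκ0.le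
            linarith [hk t j]
        _ = _ := by rw [← Finset.sum_mul, hq1, one_mul]
    have h0 : 0 < ∑ j, q j * density (L j) s2 (m.obs N t ω) :=
      Finset.sum_pos (fun j _ => mul_pos (hq j) (density_pos _ hs _)) ⟨m.z t ω, Finset.mem_univ _⟩
    refine (Real.log_le_log h0 h1).trans_eq ?_
    rw [Real.log_mul hκ0.ne' (Real.exp_pos _).ne', Real.log_exp]
    ring
  have lower : ∀ t, Real.log c + Real.log κ
        - 1 / 2 * cost (m.loading N (m.z t ω)) s2 (m.obs N t ω)
      ≤ Real.log (∑ j, q j * density (m.loading N j) s2 (m.obs N t ω)) := by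
    intro t
    have h1 : c * (κ * Real.exp (-(1 / 2) * cost (m.loading N (m.z t ω)) s2 (m.obs N t ω)))
        ≤ ∑ j, q j * density (m.loading N j) s2 (m.obs N t ω) := by
      rw [← density_eq _ hs]
      refine (mul_le_mul_of_nonneg_right (hcq (m.z t ω)) (density_pos _ hs _).le).trans ?_
      exact Finset.single_le_sum
        (f := fun j => q j * density (m.loading N j) s2 (m.obs N t ω))
        (fun j _ => (mul_pos (hq j) (density_pos _ hs _)).le) (Finset.mem_univ _)
    refine le_trans (le_of_eq ?_) (Real.log_le_log (by positivity) h1)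
    rw [Real.log_mul hc.ne' (by positivity), Real.log_mul hκ0.ne' (Real.exp_pos _).ne',
      Real.log_exp]
    ring
  have hcost : ∀ t, cost (m.loading N (m.z t ω)) s2 (m.obs N t ω)
      ≤ ℓ + (‖m.errVec N t ω‖ ^ 2 / s2 + ‖m.F t ω (m.z t ω)‖ ^ 2) := by
    intro t
    refine add_le_add (hℓ _) ?_
    have := quadForm_le (m.loading N (m.z t ω)) hs (WithLp.toLp 2 (m.obs N t ω))
      (m.F t ω (m.z t ω))
    rw [toLp_obs, common, add_sub_cancel_left] at this
    exact this
  have hsum : ∑ t ∈ Finset.range T, cost (L (k t)) s2 (m.obs N t ω)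
      ≤ ∑ t ∈ Finset.range T, (cost (m.loading N (m.z t ω)) s2 (m.obs N t ω) - 2 * Real.log c) := by
    have h1 := (Finset.sum_le_sum fun t (_ : t ∈ Finset.range T) => lower t).trans
      (hmax.trans (Finset.sum_le_sum fun t _ => upper t))
    simp only [Finset.sum_sub_distrib, Finset.sum_add_distrib, ← Finset.mul_sum] at h1 ⊢
    linarith
  refine le_trans (le_of_eq ?_)
    (hsum.trans (Finset.sum_le_sum fun t _ => sub_le_sub_right (hcost t) _))
  refine Finset.sum_congr rfl fun t _ => ?_
  rw [cost, ← toLp_obs, ← hg t (k t)]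

/-- The average excess cost controls the average squared distance between the true and the fitted
common components: since both lie in a space of bounded dimension, only the component of the errors
along that space can be fitted by mistake, and it is small on average. -/
lemma sum_excess_le {N T : ℕ} {ω : Ω} {L : m.Loadings N} {s2 : ℝ} {q : Fin m.J → ℝ}
    (hmax : m.logLik N T ω (m.loading N) s2 q ≤ m.logLik N T ω L s2 q)
    (hs : 0 < s2) (hq : ∀ j, 0 < q j) (hq1 : ∑ j, q j = 1) {c ℓ Cf b : ℝ} (hc : 0 < c)
    (hcq : ∀ j, c ≤ q j) (hℓ : ∀ j, logDetExcess (m.loading N j) s2 ≤ ℓ)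
    (hf : ∑ t ∈ Finset.range T, ‖m.F t ω (m.z t ω)‖ ^ 2 ≤ T * Cf) (hb0 : 0 ≤ b)
    (hb : ∀ v : EuclideanSpace ℝ (Fin N),
      ∑ t ∈ Finset.range T, (inner ℝ v (m.errVec N t ω)) ^ 2 ≤ T * b * ‖v‖ ^ 2) :
    ∃ (k : ℕ → Fin m.J) (g : ℕ → (k : Fin m.J) → EuclideanSpace ℝ (Fin (m.r k))),
      ∑ t ∈ Finset.range T, (logDetExcess (L (k t)) s2 + ‖g t (k t)‖ ^ 2 +
          ‖m.common N t ω - Matrix.toEuclideanLin (L (k t)) (g t (k t))‖ ^ 2 / (2 * s2))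
        ≤ T * (ℓ + Cf - 2 * Real.log c + 2 * ((∑ j, ∑ l, (m.r j + m.r l) : ℕ) : ℝ) * b / s2) := by
  obtain ⟨k, g, h⟩ := exists_assignment hmax hs hq hq1 hc hcq hℓ
  refine ⟨k, g, ?_⟩
  let W : Fin m.J → Fin m.J → Submodule ℝ (EuclideanSpace ℝ (Fin N)) := fun j l =>
    LinearMap.range (Matrix.toEuclideanLin (m.loading N j)) ⊔
      LinearMap.range (Matrix.toEuclideanLin (L l))
  have hW : ∀ j l, Module.finrank ℝ (W j l) ≤ m.r j + m.r l := by
    intro j l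
    refine (Submodule.finrank_add_le_finrank_add_finrank _ _).trans (add_le_add ?_ ?_)
    · simpa using LinearMap.finrank_range_le (Matrix.toEuclideanLin (m.loading N j))
    · simpa using LinearMap.finrank_range_le (Matrix.toEuclideanLin (L l))
  set P : Fin m.J → Fin m.J → ℕ → ℝ := fun j l t =>
    ‖(W j l).orthogonalProjectionOnto (m.errVec N t ω)‖ ^ 2 with hP
  have hproj : ∑ t ∈ Finset.range T, P (m.z t ω) (k t) t
      ≤ ((∑ j, ∑ l, (m.r j + m.r l) : ℕ) : ℝ) * (T * b) := by
    calc ∑ t ∈ Finset.range T, P (m.z t ω) (k t) t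
        ≤ ∑ t ∈ Finset.range T, ∑ j, ∑ l, P j l t := by
          refine Finset.sum_le_sum fun t _ => ?_
          refine (Finset.single_le_sum (f := fun l => P (m.z t ω) l t)
            (fun _ _ => sq_nonneg _) (Finset.mem_univ (k t))).trans ?_
          exact Finset.single_le_sum (f := fun j => ∑ l, P j l t)
            (fun _ _ => Finset.sum_nonneg fun _ _ => sq_nonneg _) (Finset.mem_univ (m.z t ω))
      _ = ∑ j, ∑ l, ∑ t ∈ Finset.range T, P j l t := by
          rw [Finset.sum_comm]
          exact Finset.sum_congr rfl fun j _ => Finset.sum_comm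
      _ ≤ ∑ j, ∑ l, ((m.r j + m.r l : ℕ) : ℝ) * (T * b) := by
          refine Finset.sum_le_sum fun j _ => Finset.sum_le_sum fun l _ => ?_
          refine (sum_norm_sq_orthogonalProjection_le _ (W j l) _ hb).trans ?_
          exact mul_le_mul_of_nonneg_right (by exact_mod_cast hW j l) (by positivity)
      _ = _ := by push_cast; simp only [Finset.sum_mul]
  -- a misfit `d_t` can lower the residual `e_t + d_t` only through the projection of `e_t` onto `W`
  have hterm : ∀ t, logDetExcess (L (k t)) s2 + ‖g t (k t)‖ ^ 2 +
        ‖m.common N t ω - Matrix.toEuclideanLin (L (k t)) (g t (k t))‖ ^ 2 / (2 * s2)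
      ≤ (logDetExcess (L (k t)) s2 +
          (‖m.common N t ω + m.errVec N t ω - Matrix.toEuclideanLin (L (k t)) (g t (k t))‖ ^ 2 / s2
            + ‖g t (k t)‖ ^ 2)) - ‖m.errVec N t ω‖ ^ 2 / s2 + 2 / s2 * P (m.z t ω) (k t) t := by
    intro t
    have hmem : m.common N t ω - Matrix.toEuclideanLin (L (k t)) (g t (k t))
        ∈ W (m.z t ω) (k t) :=
      Submodule.sub_mem _ (Submodule.mem_sup_left (LinearMap.mem_range_self _ _))
        (Submodule.mem_sup_right (LinearMap.mem_range_self _ _))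
    have h1 := norm_add_sq_ge _ (m.errVec N t ω) hmem
    rw [show m.common N t ω - Matrix.toEuclideanLin (L (k t)) (g t (k t)) + m.errVec N t ω
      = m.common N t ω + m.errVec N t ω - Matrix.toEuclideanLin (L (k t)) (g t (k t)) by abel] at h1
    have h2 := div_le_div_of_nonneg_right h1 hs.le
    have h3 : (‖m.errVec N t ω‖ ^ 2
        + ‖m.common N t ω - Matrix.toEuclideanLin (L (k t)) (g t (k t))‖ ^ 2 / 2
        - 2 * P (m.z t ω) (k t) t) / s2 = ‖m.errVec N t ω‖ ^ 2 / s2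
        + ‖m.common N t ω - Matrix.toEuclideanLin (L (k t)) (g t (k t))‖ ^ 2 / (2 * s2)
        - 2 / s2 * P (m.z t ω) (k t) t := by
      field_simp
    rw [h3] at h2
    linarith
  refine (Finset.sum_le_sum fun t _ => hterm t).trans ?_
  rw [Finset.sum_add_distrib, Finset.sum_sub_distrib, ← Finset.mul_sum]
  have h4 := mul_le_mul_of_nonneg_left hproj (by positivity : 0 ≤ 2 / s2)
  have h5 : 2 / s2 * (((∑ j, ∑ l, (m.r j + m.r l) : ℕ) : ℝ) * (T * b))
      = T * (2 * ((∑ j, ∑ l, (m.r j + m.r l) : ℕ) : ℝ) * b / s2) := by ring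
  rw [h5] at h4
  simp only [Finset.sum_add_distrib, Finset.sum_sub_distrib, Finset.sum_const, Finset.card_range,
    nsmul_eq_mul] at h h4 ⊢
  push_cast at h h4 ⊢
  linarith

/-- Some estimated regime fits the true regime `j`: by the pigeonhole principle some `k` is assigned
to a non-negligible share of the times in regime `j`, and along these times the factors are
nondegenerate. -/
lemma exists_fits {N T : ℕ} {ω : Ω} {L : m.Loadings N} {s2 : ℝ} (hs : 0 < s2) (hT : 0 < T)
    {k : ℕ → Fin m.J} {g : ℕ → (k : Fin m.J) → EuclideanSpace ℝ (Fin (m.r k))} {H : ℝ}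
    (h : ∑ t ∈ Finset.range T, (logDetExcess (L (k t)) s2 + ‖g t (k t)‖ ^ 2 +
          ‖m.common N t ω - Matrix.toEuclideanLin (L (k t)) (g t (k t))‖ ^ 2 / (2 * s2)) ≤ T * H)
    {j : Fin m.J} {p κ d C : ℝ} (hp : 0 < p) (hκ : 0 < κ) (hd : 0 ≤ d) (hC : s2 ≤ C)
    (hcount : T * p / 2 ≤ ∑ t ∈ Finset.range T, m.ind t j ω)
    (hnd : ∀ A : Finset ℕ, A ⊆ Finset.range T → (∀ t ∈ A, m.z t ω = j) →
      1 / (2 * m.J) * (T * p) ≤ (A.card : ℝ) → ∀ v : EuclideanSpace ℝ (Fin (m.r j)),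
        κ * ‖v‖ ^ 2 ≤ (A.card : ℝ)⁻¹ * ∑ t ∈ A, (inner ℝ (m.F t ω j) v) ^ 2)
    (hd1 : 2 * m.J * H ≤ p * (N * d ^ 2)) (hd2 : 2 * m.J * (H * (1 + 2 * C)) ≤ κ * p * (N * d ^ 2)) :
    ∃ k, m.Fits L s2 d j k := by
  have hJ : 0 < m.J := (Nat.zero_le _).trans_lt j.2
  have hJ' : (0 : ℝ) < m.J := by exact_mod_cast hJ
  have hT' : (0 : ℝ) < T := by exact_mod_cast hT
  set A : Fin m.J → Finset ℕ := fun l =>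
    (Finset.range T).filter fun t => m.z t ω = j ∧ k t = l with hA
  -- pigeonhole principle
  obtain ⟨l, hl⟩ : ∃ l, 1 / (2 * m.J) * (T * p) ≤ ((A l).card : ℝ) := by
    by_contra! hcon
    have h1 : ∑ t ∈ Finset.range T, m.ind t j ω = ∑ l, ((A l).card : ℝ) := by
      have : ∀ t, m.ind t j ω = ∑ l, if m.z t ω = j ∧ k t = l then (1 : ℝ) else 0 := by
        intro t
        by_cases hz : m.z t ω = j <;> simp [ind, hz]
      simp_rw [this]
      rw [Finset.sum_comm]
      simp [hA]
    have h2 : ∑ l, ((A l).card : ℝ) < ∑ _l : Fin m.J, 1 / (2 * m.J) * (T * p) :=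
      Finset.sum_lt_sum_of_nonempty ⟨j, Finset.mem_univ j⟩ fun l _ => hcon l
    rw [← h1, Finset.sum_const, Finset.card_univ, Fintype.card_fin, nsmul_eq_mul] at h2
    have h3 : (m.J : ℝ) * (1 / (2 * m.J) * (T * p)) = T * p / 2 := by field_simp
    linarith
  refine ⟨l, ?_⟩
  have hsub : A l ⊆ Finset.range T := Finset.filter_subset _ _
  have hmem : ∀ t ∈ A l, m.z t ω = j ∧ k t = l := fun t ht => (Finset.mem_filter.1 ht).2
  have hcard : 0 < ((A l).card : ℝ) := lt_of_lt_of_le (by positivity) hl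
  have hcard2 : T * p ≤ 2 * m.J * (A l).card := by
    have := mul_le_mul_of_nonneg_left hl (by positivity : (0 : ℝ) ≤ 2 * m.J)
    have h3 : 2 * (m.J : ℝ) * (1 / (2 * m.J) * (T * p)) = T * p := by field_simp
    linarith
  have hsum : ∑ t ∈ A l, (logDetExcess (L l) s2 + ‖g t l‖ ^ 2 +
      ‖Matrix.toEuclideanLin (m.loading N j) (m.F t ω j)
        - Matrix.toEuclideanLin (L l) (g t l)‖ ^ 2 / (2 * s2)) ≤ T * H := by
    refine le_trans (le_of_eq ?_) ((Finset.sum_le_sum_of_subset_of_nonneg hsub ?_).trans h)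
    · refine Finset.sum_congr rfl fun t ht => ?_
      rw [(hmem t ht).2, m.common_eq (hmem t ht).1]
    · intro t _ _
      have := logDetExcess_nonneg (L (k t)) hs
      positivity
  have hld := logDetExcess_nonneg (L l) hs
  rw [Finset.sum_add_distrib, Finset.sum_add_distrib, Finset.sum_const, nsmul_eq_mul,
    ← Finset.sum_div] at hsum
  have hg0 : 0 ≤ ∑ t ∈ A l, ‖g t l‖ ^ 2 := Finset.sum_nonneg fun _ _ => sq_nonneg _
  set Q := ∑ t ∈ A l, ‖Matrix.toEuclideanLin (m.loading N j) (m.F t ω j)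
        - Matrix.toEuclideanLin (L l) (g t l)‖ ^ 2 with hQ
  have hQ0 : 0 ≤ Q := Finset.sum_nonneg fun _ _ => sq_nonneg _
  have hQ1 : 0 ≤ Q / (2 * s2) := by positivity
  have hld1 : 0 ≤ ((A l).card : ℝ) * logDetExcess (L l) s2 := by positivity
  have hH : 0 ≤ T * H := by linarith
  have hκb : T * H * (1 + 2 * C) ≤ (κ * (A l).card) * (N * d ^ 2) := by
    have h1 := mul_le_mul_of_nonneg_left hd2 hT'.le
    have h2 := mul_le_mul_of_nonneg_right hcard2 (by positivity : 0 ≤ κ * (N * d ^ 2))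
    have h3 : 2 * m.J * (T * H * (1 + 2 * C)) ≤ 2 * m.J * ((κ * (A l).card) * (N * d ^ 2)) := by
      nlinarith
    exact le_of_mul_le_mul_left h3 (by positivity)
  have hC0 : 0 < C := hs.trans_le hC
  refine ⟨?_, fun f => ?_⟩
  · have h1 := mul_le_mul_of_nonneg_left hd1 hT'.le
    have h2 := mul_le_mul_of_nonneg_right hcard2 (by positivity : 0 ≤ N * d ^ 2)
    have h3 : 2 * m.J * (((A l).card : ℝ) * logDetExcess (L l) s2)
        ≤ 2 * m.J * ((A l).card * (N * d ^ 2)) := by nlinarith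
    exact le_of_mul_le_mul_left (le_of_mul_le_mul_left h3 (by positivity)) hcard
  · obtain ⟨g', hg1, hg2⟩ := exists_fit_of_average (Matrix.toEuclideanLin (m.loading N j))
      (Matrix.toEuclideanLin (L l)) (A l) (fun t => m.F t ω j) (fun t => g t l)
      (κ := κ * (A l).card) (b := N * d ^ 2) (by positivity)
      (by
        intro w
        have := mul_le_mul_of_nonneg_left (hnd (A l) hsub (fun t ht => (hmem t ht).1) hl w) hcard.le
        rw [← mul_assoc, ← mul_assoc, mul_inv_cancel₀ hcard.ne', one_mul] at this
        linarith)
      (by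
        refine le_trans ?_ hκb
        nlinarith)
      (by
        refine le_trans ?_ hκb
        have : Q / (2 * s2) ≤ T * H := by linarith
        rw [div_le_iff₀ (by positivity)] at this
        refine this.trans (mul_le_mul_of_nonneg_left (by linarith) hH)) f
    have hN : (N : ℝ) * d ^ 2 * ‖f‖ ^ 2 = (√N * d * ‖f‖) ^ 2 := by
      rw [mul_pow, mul_pow, Real.sq_sqrt (Nat.cast_nonneg N)]
    rw [hN] at hg1 hg2
    have h0 : 0 ≤ √N * d * ‖f‖ := by positivity
    exact ⟨g', (sq_le_sq₀ (norm_nonneg _) h0).1 hg1, (sq_le_sq₀ (norm_nonneg _) h0).1 hg2⟩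

end Model

namespace Model

variable {Ω : Type*} [MeasurableSpace Ω] {m : Model Ω}

/-! ### Matching and posterior probabilities for one sample -/

/-- Bounds on the true loadings of the first `N` units: `Λ_j` distorts norms by factors between
`c √N` and `K √N`, and every regime has a factor of norm at most `R` whose common component is at
distance at least `c √N` from the loading spaces of the other regimes. -/
structure RegularLoadings (m : Model Ω) (N : ℕ) (c K R : ℝ) : Prop where
  lower : ∀ j f, c * √N * ‖f‖ ≤ ‖Matrix.toEuclideanLin (m.loading N j) f‖
  upper : ∀ j f, ‖Matrix.toEuclideanLin (m.loading N j) f‖ ≤ K * √N * ‖f‖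
  separated : ∀ j, ∃ f, ‖f‖ ≤ R ∧ ∀ k, j ≠ k → ∀ g,
    c * √N ≤ ‖Matrix.toEuclideanLin (m.loading N j) f - Matrix.toEuclideanLin (m.loading N k) g‖

section

variable {N : ℕ} {c K R : ℝ}

lemma RegularLoadings.injective (h : m.RegularLoadings N c K R) (hc : 0 < c) (hN : 0 < N)
    (j : Fin m.J) : Function.Injective (Matrix.toEuclideanLin (m.loading N j)) :=
  injective_of_le_norm (mul_pos hc (Real.sqrt_pos.2 (by exact_mod_cast hN))) (h.lower j)

lemma RegularLoadings.approx (h : m.RegularLoadings N c K R) (hc : 0 < c) {L : m.Loadings N}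
    {s2 d : ℝ} (hd : 0 ≤ d) {j k : Fin m.J} (hfit : m.Fits L s2 d j k)
    (f : EuclideanSpace ℝ (Fin (m.r j))) : ∃ g, ‖Matrix.toEuclideanLin (m.loading N j) f
      - Matrix.toEuclideanLin (L k) g‖ ≤ d / c * ‖Matrix.toEuclideanLin (m.loading N j) f‖ := by
  obtain ⟨g, -, hg⟩ := hfit.2 f
  refine ⟨g, hg.trans ?_⟩
  calc √N * d * ‖f‖ = d / c * (c * √N * ‖f‖) := by field_simp
    _ ≤ _ := mul_le_mul_of_nonneg_left (h.lower j f) (by positivity)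

/-- If every true regime is fitted by some estimated regime, then the fitting regimes form a
permutation that preserves the numbers of factors. -/
lemma RegularLoadings.bijective (h : m.RegularLoadings N c K R) (hc : 0 < c) (hK : 0 ≤ K)
    (hN : 0 < N) {L : m.Loadings N} {s2 d : ℝ} (hd : 0 ≤ d) (hd1 : d ≤ 1) (hdc : d ≤ c / 2)
    (hdR : d * R * (1 + 2 * (K + 1) / c) < c) {σ : Fin m.J → Fin m.J}
    (hfit : ∀ j, m.Fits L s2 d j (σ j)) :
    Function.Bijective σ ∧ ∀ j, m.r (σ j) = m.r j := by
  have hs : 0 < √(N : ℝ) := Real.sqrt_pos.2 (by exact_mod_cast hN)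
  have hε : d / c ≤ 1 / 2 := by rw [div_le_iff₀ hc]; linarith
  refine bijective_of_rank (fun j => ?_) (fun j k hjk hσ => ?_)
  · have := finrank_le_of_approx (by linarith : d / c < 1) (h.injective hc hN j)
      (h.approx hc hd (hfit j))
    simpa using this
  · by_contra! hle
    -- the loading space of `j` would contain the fitted space, hence nearly the one of `k`
    obtain ⟨f0, hf0, hsep⟩ := h.separated k
    have hfit' : m.Fits L s2 d k (σ j) := hσ ▸ hfit k
    obtain ⟨g, -, hg⟩ := hfit'.2 f0
    obtain ⟨f, hf⟩ := exists_approx_of_finrank_le (by positivity : 0 ≤ d / c) hε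
      (h.injective hc hN j) (h.approx hc hd (hfit j)) (by simpa using hle) g
    have h1 := hsep j (Ne.symm hjk) f
    have h2 := h.upper k f0
    set a := Matrix.toEuclideanLin (m.loading N k) f0
    set w := Matrix.toEuclideanLin (L (σ j)) g
    set v := Matrix.toEuclideanLin (m.loading N j) f
    have hR : 0 ≤ R := (norm_nonneg _).trans hf0
    have h3 : ‖a - w‖ ≤ √N * d * R := hg.trans (by gcongr)
    have h4 : ‖w‖ ≤ (K + 1) * √N * R := by
      have e1 : ‖w‖ ≤ ‖a‖ + ‖a - w‖ := by
        have := norm_sub_le a (a - w)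
        rwa [sub_sub_cancel] at this
      have e2 : ‖a‖ ≤ K * √N * R := h2.trans (by gcongr)
      have e3 : √N * d * R ≤ √N * 1 * R := by gcongr
      linarith
    have h5 : ‖w - v‖ ≤ 2 * (d / c) * ((K + 1) * √N * R) := hf.trans (by gcongr)
    have h6 : ‖a - v‖ ≤ ‖a - w‖ + ‖w - v‖ := norm_sub_le_norm_sub_add_norm_sub _ _ _
    have h7 : √N * d * R + 2 * (d / c) * ((K + 1) * √N * R)
        = √N * (d * R * (1 + 2 * (K + 1) / c)) := by field_simp
    have h8 : √N * (d * R * (1 + 2 * (K + 1) / c)) < √N * c := by gcongr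
    linarith

/-- Conditions at time `t` under which the posterior of the regime is decided: `R` and `√N Y` bound
the factor and the error vector, `√N X` the loading-weighted errors, and these bounds are small
relative to `N` and to the error `d` of the estimated loadings, up to the tolerance `τ`. -/
structure RegularTime (m : Model Ω) (N t : ℕ) (ω : Ω) (c d τ R X Y : ℝ) : Prop where
  one_le_R : 1 ≤ R
  one_le_Y : 1 ≤ Y
  nonneg_X : 0 ≤ X
  factor : ‖m.F t ω (m.z t ω)‖ ≤ R
  error : ‖m.errVec N t ω‖ ≤ √N * Y
  loading_error : ∀ j f, |inner ℝ (m.errVec N t ω) (Matrix.toEuclideanLin (m.loading N j) f)|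
    ≤ √N * X * ‖f‖
  separated : ∀ k, m.z t ω ≠ k → ∀ g,
    c * √N ≤ ‖m.common N t ω - Matrix.toEuclideanLin (m.loading N k) g‖
  rate_d : d * Y * R ≤ τ
  rate_X : X * R ≤ τ * √N

lemma exists_pos_mul_le {b : ℝ} (a : ℝ) (hb : 0 < b) (ha : 0 ≤ a) :
    ∃ τ : ℝ, 0 < τ ∧ ∀ τ', 0 ≤ τ' → τ' ≤ τ → τ' * a ≤ b := by
  refine ⟨b / (a + 1), by positivity, fun τ' h0 h => ?_⟩
  rw [le_div_iff₀ (by positivity)] at h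
  nlinarith

/-- At a regular time, the log-likelihood of the true regime exceeds the others by a multiple of
`N`, and the posterior probabilities are exponentially close to the indicators of the regime. -/
lemma exists_abs_regimeProb_sub_ind_le (m : Model Ω) {c K C : ℝ} (hc : 0 < c) (hK : 0 ≤ K)
    (hC : 0 < C) : ∃ τ γ : ℝ, 0 < τ ∧ 0 < γ ∧ ∀ (N t : ℕ) (ω : Ω) (L : m.Loadings N) (s2 d : ℝ)
      (q : Fin m.J → ℝ) (π : Equiv.Perm (Fin m.J)) (cq R R0 X Y : ℝ),
      0 < N → m.RegularLoadings N c K R0 → (∀ j, m.Fits L s2 d j (π j)) →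
      (∀ j, m.r (π j) = m.r j) → 0 ≤ d → d ≤ c / 2 → m.RegularTime N t ω c d τ R X Y →
      0 < s2 → s2 ≤ C → 0 < cq → (∀ j, 0 < q j) → ∑ j, q j = 1 → (∀ j, cq ≤ q j) →
      ∀ j, |m.regimeProb N ω L s2 q t (π j) - m.ind t j ω| ≤ cq⁻¹ * Real.exp (-(γ * N)) := by
  obtain ⟨τ1, hτ1, h1⟩ := exists_pos_mul_le (2 * (c + K)) (by positivity : 0 < c / 2) (by positivity)
  obtain ⟨τ2, hτ2, h2⟩ := exists_pos_mul_le (2 + 2 * c⁻¹ * (c + K) + 4 * (c + K))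
    (by positivity : 0 < c ^ 2 / 8) (by positivity)
  obtain ⟨τ3, hτ3, h3⟩ := exists_pos_mul_le 3 (by positivity : 0 < c ^ 2 / 32) (by positivity)
  obtain ⟨τ4, hτ4, h4⟩ := exists_pos_mul_le 2 (by positivity : 0 < c ^ 2 / (32 * C)) (by positivity)
  obtain ⟨τ5, hτ5, h5⟩ := exists_pos_mul_le 1 (by norm_num : (0 : ℝ) < 1 / 2) (by positivity)
  set τ0 := min (min τ1 τ2) (min (min τ3 τ4) τ5) with hτ0
  have hτ0' : 0 < τ0 := by positivity
  -- the approximation error of the loading spaces is `2 d / c`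
  set τ := min τ0 (τ0 * c / 2) with hτ
  have hτpos : 0 < τ := by positivity
  have hττ0 : τ ≤ τ0 := min_le_left _ _
  have hl1 : τ0 ≤ τ1 := (min_le_left _ _).trans (min_le_left _ _)
  have hl2 : τ0 ≤ τ2 := (min_le_left _ _).trans (min_le_right _ _)
  have hl3 : τ0 ≤ τ3 := (min_le_right _ _).trans ((min_le_left _ _).trans (min_le_left _ _))
  have hl4 : τ0 ≤ τ4 := (min_le_right _ _).trans ((min_le_left _ _).trans (min_le_right _ _))
  have hl5 : τ0 ≤ τ5 := (min_le_right _ _).trans (min_le_right _ _)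
  refine ⟨τ, c ^ 2 / (32 * C), hτpos, by positivity, ?_⟩
  intro N t ω L s2 d q π cq R R0 X Y hN hL hfit hr hd hdc ht hs hsC hcq hq hq1 hcq' l
  have hs' : 0 < √(N : ℝ) := Real.sqrt_pos.2 (by exact_mod_cast hN)
  have hsq : √(N : ℝ) ^ 2 = N := Real.sq_sqrt (Nat.cast_nonneg N)
  have hε : d / c ≤ 1 / 2 := by rw [div_le_iff₀ hc]; linarith
  have hR := ht.one_le_R
  have hY := ht.one_le_Y
  have hτhalf : τ ≤ 1 / 2 := by have := h5 τ hτpos.le (hττ0.trans hl5); linarith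
  have hdYR := ht.rate_d
  have hdR : d * R ≤ τ := by
    refine le_trans ?_ hdYR
    nlinarith [mul_nonneg hd (by linarith : (0:ℝ) ≤ R)]
  have hdτ : d ≤ τ := by nlinarith
  set j := m.z t ω with hj
  set e := m.errVec N t ω with he
  set a := m.common N t ω with ha
  have hfR : ‖m.F t ω j‖ ≤ R := ht.factor
  have haR : ‖a‖ ≤ K * √N * R := (hL.upper j _).trans (by gcongr)
  have hright : cost (L (π j)) s2 (m.obs N t ω)
      ≤ ‖e‖ ^ 2 / s2 + 3 * τ * N / s2 + 2 * τ * N := by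
    obtain ⟨g, hg1, hg2⟩ := (hfit j).2 (m.F t ω j)
    have e1 : m.obs N t ω ⬝ᵥ ((L (π j) * (L (π j))ᵀ + s2 • (1 : Matrix (Fin N) (Fin N) ℝ))⁻¹ *ᵥ
          m.obs N t ω) ≤ ‖a + e - Matrix.toEuclideanLin (L (π j)) g‖ ^ 2 / s2 + ‖g‖ ^ 2 :=
      quadForm_le (L (π j)) hs (WithLp.toLp 2 (m.obs N t ω)) g
    have e2 := norm_sq_le_of_close (a := a) (e := e) hs'.le hd hR hY (by linarith)
      (hg2.trans (by gcongr)) ht.error hdYR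
    rw [hsq] at e2
    have e3 : ‖g‖ ^ 2 ≤ τ * N := by
      calc ‖g‖ ^ 2 ≤ (√N * d * R) ^ 2 := by gcongr; exact hg1.trans (by gcongr)
        _ = (d * R) * (d * R) * √N ^ 2 := by ring
        _ ≤ τ * 1 * N := by rw [hsq]; gcongr; linarith
        _ = _ := by ring
    have e4 : logDetExcess (L (π j)) s2 ≤ τ * N := by
      refine (hfit j).1.trans ?_
      calc (N : ℝ) * d ^ 2 = d * d * N := by ring
        _ ≤ τ * 1 * N := by gcongr; linarith
        _ = _ := by ring
    have e5 := div_le_div_of_nonneg_right e2 hs.le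
    rw [add_div] at e5
    rw [cost]
    linarith
  have hwrong : ∀ l, l ≠ j →
      ‖e‖ ^ 2 / s2 + c ^ 2 / 8 * N / s2 ≤ cost (L (π l)) s2 (m.obs N t ω) := by
    intro l hl
    obtain ⟨g, hg⟩ := exists_quadForm_eq (L (π l)) hs (WithLp.toLp 2 (m.obs N t ω))
    obtain ⟨f, hf⟩ := exists_approx_of_finrank_le (by positivity : 0 ≤ d / c) hε
      (hL.injective hc hN l) (hL.approx hc hd (hfit l)) (by simp [hr]) g
    have hdR2 : 2 * (d / c) * Y * R ≤ τ0 := by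
      have : d * Y * R ≤ τ0 * c / 2 := hdYR.trans (min_le_right _ _)
      calc 2 * (d / c) * Y * R = 2 / c * (d * Y * R) := by ring
        _ ≤ 2 / c * (τ0 * c / 2) := by gcongr
        _ = τ0 := by field_simp
    have hev : |inner ℝ e (Matrix.toEuclideanLin (m.loading N l) f)|
        ≤ c⁻¹ * X * ‖Matrix.toEuclideanLin (m.loading N l) f‖ := by
      refine (ht.loading_error l f).trans ?_
      calc √N * X * ‖f‖ = c⁻¹ * X * (c * √N * ‖f‖) := by field_simp
        _ ≤ _ := mul_le_mul_of_nonneg_left (hL.lower l f)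
          (mul_nonneg (by positivity) ht.nonneg_X)
    have hea : |inner ℝ e a| ≤ √N * X * R := by
      refine (ht.loading_error j (m.F t ω j)).trans ?_
      have := ht.nonneg_X
      gcongr
    have key := norm_sq_ge_of_separated (a := a) (e := e) hs' hc hK (by positivity : 0 ≤ c⁻¹)
      (by positivity : 0 ≤ 2 * (d / c)) hR ht.nonneg_X hY hf (ht.separated l (Ne.symm hl) f) haR hea
      hev ht.error hdR2 (ht.rate_X.trans (mul_le_mul_of_nonneg_right hττ0 hs'.le))
      (by have := h5 τ0 hτ0'.le hl5; linarith)
      (by have := h1 τ0 hτ0'.le hl1; linarith) (h2 τ0 hτ0'.le hl2)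
    rw [hsq] at key
    have e5 := div_le_div_of_nonneg_right key hs.le
    rw [add_div] at e5
    have e6 : m.obs N t ω ⬝ᵥ ((L (π l) * (L (π l))ᵀ + s2 • (1 : Matrix (Fin N) (Fin N) ℝ))⁻¹ *ᵥ
          m.obs N t ω) = ‖a + e - Matrix.toEuclideanLin (L (π l)) g‖ ^ 2 / s2 + ‖g‖ ^ 2 := hg
    rw [cost]
    have := logDetExcess_nonneg (L (π l)) hs
    have := sq_nonneg ‖g‖
    linarith
  have hgap : ∀ l, l ≠ j → 2 * (c ^ 2 / (32 * C) * N)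
      ≤ cost (L (π l)) s2 (m.obs N t ω) - cost (L (π j)) s2 (m.obs N t ω) := by
    intro l hl
    have e1 := hwrong l hl
    have e3 : τ * 3 ≤ c ^ 2 / 32 := h3 τ hτpos.le (hττ0.trans hl3)
    have e4 : τ * 2 ≤ c ^ 2 / (32 * C) := h4 τ hτpos.le (hττ0.trans hl4)
    have hN0 : (0 : ℝ) ≤ N := Nat.cast_nonneg N
    have e5 : 3 * (c ^ 2 / (32 * C)) * N ≤ (c ^ 2 / 8 - 3 * τ) * N / s2 := by
      rw [le_div_iff₀ hs]
      calc 3 * (c ^ 2 / (32 * C)) * N * s2 ≤ 3 * (c ^ 2 / (32 * C)) * N * C := by gcongr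
        _ = 3 * (c ^ 2 / 32) * N := by field_simp
        _ ≤ _ := by gcongr; linarith
    have e6 : (c ^ 2 / 8 - 3 * τ) * N / s2 = c ^ 2 / 8 * N / s2 - 3 * τ * N / s2 := by ring
    have e7 := mul_le_mul_of_nonneg_right e4 hN0
    linarith
  -- compare the densities of the relabeled regimes
  have hD : ∀ l, l ≠ j → density (L (π l)) s2 (m.obs N t ω)
      ≤ Real.exp (-(c ^ 2 / (32 * C) * N)) * density (L (π j)) s2 (m.obs N t ω) := by
    intro l hl
    rw [density_eq _ hs, density_eq _ hs, mul_left_comm, ← Real.exp_add]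
    refine mul_le_mul_of_nonneg_left (Real.exp_le_exp.2 ?_) (by positivity)
    linarith [hgap l hl]
  have hfinal := abs_posterior_sub_le (q := fun k => q (π k))
    (D := fun k => density (L (π k)) s2 (m.obs N t ω)) hcq (fun k => hq _)
    ((Equiv.sum_comp π q).trans hq1) (fun k => density_pos _ hs _) (hcq' (π j)) hD
    (Real.exp_pos _).le l
  rw [Equiv.sum_comp π fun k => q k * density (L k) s2 (m.obs N t ω)] at hfinal
  exact hfinal

end

end Model

/-! ### Events of probability close to one -/

/-- Along the filter `l`, the event `p n` fails eventually with (outer) probability at most `θ`. -/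
def Likely {Ω ι : Type*} [MeasurableSpace Ω] (P : Measure Ω) (l : Filter ι) (θ : ℝ)
    (p : ι → Ω → Prop) : Prop :=
  ∀ᶠ n in l, P {ω | ¬ p n ω} ≤ ENNReal.ofReal θ

section Likely

variable {Ω ι : Type*} [MeasurableSpace Ω] {P : Measure Ω} {l : Filter ι} {θ θ' : ℝ}
  {p q : ι → Ω → Prop}

lemma Likely.mono (h : Likely P l θ p) (hpq : ∀ᶠ n in l, ∀ ω, p n ω → q n ω) : Likely P l θ q := by
  filter_upwards [h, hpq] with n h1 h2
  refine le_trans (measure_mono ?_) h1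
  intro ω hω hp
  exact hω (h2 ω hp)

lemma Likely.weaken (h : Likely P l θ p) (hθ : θ ≤ θ') : Likely P l θ' p := by
  filter_upwards [h] with n hn using hn.trans (ENNReal.ofReal_le_ofReal hθ)

lemma Likely.and (h : Likely P l θ p) (h' : Likely P l θ' q) (hθ : 0 ≤ θ) (hθ' : 0 ≤ θ') :
    Likely P l (θ + θ') fun n ω => p n ω ∧ q n ω := by
  filter_upwards [h, h'] with n h1 h2
  rw [ENNReal.ofReal_add hθ hθ']
  refine le_trans (measure_mono ?_) ((measure_union_le _ _).trans (add_le_add h1 h2))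
  intro ω hω
  by_cases hp : p n ω
  · exact Or.inr fun hq => hω ⟨hp, hq⟩
  · exact Or.inl hp

lemma Likely.forall {J : Type*} [Fintype J] {p : J → ι → Ω → Prop}
    (h : ∀ j, Likely P l θ (p j)) : Likely P l (Fintype.card J * θ) fun n ω => ∀ j, p j n ω := by
  filter_upwards [eventually_all.2 h] with n h1
  have hsub : {ω | ¬ ∀ j, p j n ω} ⊆ ⋃ j, {ω | ¬ p j n ω} := by
    intro ω hω
    simpa using hω
  refine (measure_mono hsub).trans ((measure_iUnion_fintype_le _ _).trans ?_)
  refine (Finset.sum_le_sum fun j _ => h1 j).trans_eq ?_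
  rw [Finset.sum_const, nsmul_eq_mul, ENNReal.ofReal_mul (by positivity)]
  simp

lemma likely_of_tendsto (h : Tendsto (fun n => P {ω | ¬ p n ω}) l (𝓝 0)) (hθ : 0 < θ) :
    Likely P l θ p :=
  (ENNReal.tendsto_nhds_zero.1 h) _ (ENNReal.ofReal_pos.2 hθ)

lemma likely_of_ae (h : ∀ᶠ n in l, ∀ᵐ ω ∂P, p n ω) : Likely P l θ p := by
  filter_upwards [h] with n hn
  rw [ae_iff.1 hn]
  exact zero_le

lemma Likely.comp_tendsto (h : Likely P l θ p) {κ : Type*} {l' : Filter κ} {u : κ → ι}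
    (hu : Tendsto u l' l) : Likely P l' θ fun n ω => p (u n) ω :=
  hu.eventually h

lemma Likely.tendsto (h : ∀ θ : ℝ, 0 < θ → Likely P l θ p) :
    Tendsto (fun n => P {ω | ¬ p n ω}) l (𝓝 0) := by
  rw [ENNReal.tendsto_nhds_zero]
  intro ε hε
  rcases eq_or_ne ε ⊤ with rfl | hε'
  · exact Eventually.of_forall fun _ => le_top
  · have := h ε.toReal (ENNReal.toReal_pos hε.ne' hε')
    filter_upwards [this] with n hn
    rwa [ENNReal.ofReal_toReal hε'] at hn

lemma Likely.exists [IsProbabilityMeasure P] [l.NeBot] (h : Likely P l θ p) (hθ : θ < 1)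
    {s : Ω → Prop} (hs : ∀ᵐ ω ∂P, s ω) : ∃ n ω, p n ω ∧ s ω := by
  obtain ⟨n, hn⟩ := Eventually.exists h
  by_contra! hcon
  have h1 : ∀ᵐ ω ∂P, ω ∈ {ω | ¬ p n ω} := by
    filter_upwards [hs] with ω hω hp
    exact hcon n ω hp hω
  have h2 : P {ω | ¬ p n ω} = 1 := (measure_congr (eventuallyEq_univ.2 h1)).trans measure_univ
  rw [h2] at hn
  exact absurd hn (not_le.2 (by simpa using ENNReal.ofReal_lt_ofReal_iff one_pos |>.2 hθ))

lemma likely_of_tendstoInMeasure {X : ι → Ω → ℝ} {a : ℝ} (h : TendstoInMeasure P X l fun _ => a)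
    {δ : ℝ} (hδ : 0 < δ) (hθ : 0 < θ) : Likely P l θ fun n ω => |X n ω - a| < δ := by
  refine likely_of_tendsto ?_ hθ
  have := (tendstoInMeasure_iff_norm.1 h) δ hδ
  simpa [not_lt, Real.norm_eq_abs] using this

/-- Markov's inequality. -/
lemma measure_not_le_le_of_expNonneg {X : Ω → ℝ} (hX : Measurable X) {M C : ℝ}
    (h : expNonneg P X ≤ ENNReal.ofReal M) (hC : 0 < C) :
    P {ω | ¬ X ω ≤ C} ≤ ENNReal.ofReal (M / C) := by
  have h1 := meas_ge_le_lintegral_div (μ := P) (f := fun ω => ENNReal.ofReal (X ω))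
    hX.ennreal_ofReal.aemeasurable (ε := ENNReal.ofReal C) (by simpa using hC) ENNReal.ofReal_ne_top
  refine le_trans (measure_mono ?_) (h1.trans ?_)
  · intro ω hω
    exact ENNReal.ofReal_le_ofReal (not_le.1 hω).le
  · rw [ENNReal.ofReal_div_of_pos hC]
    exact ENNReal.div_le_div_right h _

end Likely

lemma exists_pos_le {J : Type*} [Finite J] {c : J → ℝ} (hc : ∀ j, 0 < c j) :
    ∃ c0, 0 < c0 ∧ ∀ j, c0 ≤ c j := by
  have h : ∀ᶠ x in 𝓝[>] (0 : ℝ), ∀ j, x ≤ c j :=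
    eventually_all.2 fun j => by
      filter_upwards [Ioo_mem_nhdsGT (hc j)] with x hx using hx.2.le
  obtain ⟨x, hx, h0⟩ := (h.and self_mem_nhdsWithin).exists
  exact ⟨x, h0, hx⟩

/-! ### The true loadings -/

lemma exists_forall_le_of_posDef {k : ℕ} {S : Matrix (Fin k) (Fin k) ℝ} (hS : S.PosDef) :
    ∃ c : ℝ, 0 < c ∧ ∀ v : EuclideanSpace ℝ (Fin k), c * ‖v‖ ^ 2 ≤ v.ofLp ⬝ᵥ (S *ᵥ v.ofLp) := by
  set φ : EuclideanSpace ℝ (Fin k) → ℝ := fun v => v.ofLp ⬝ᵥ (S *ᵥ v.ofLp) with hφ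
  have hcont : Continuous φ := by
    have h1 : Continuous fun v : EuclideanSpace ℝ (Fin k) => v.ofLp := PiLp.continuous_ofLp 2 _
    exact h1.dotProduct (continuous_const.matrix_mulVec h1)
  have hpos : ∀ v : EuclideanSpace ℝ (Fin k), v ≠ 0 → 0 < φ v := by
    intro v hv
    have := hS.dotProduct_mulVec_pos (x := v.ofLp) (by simpa using hv)
    simpa using this
  have hhom : ∀ (a : ℝ) v, φ (a • v) = a ^ 2 * φ v := by
    intro a v
    simp only [hφ, WithLp.ofLp_smul, mulVec_smul, dotProduct_smul, smul_dotProduct, smul_eq_mul]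
    ring
  by_cases hne : (Metric.sphere (0 : EuclideanSpace ℝ (Fin k)) 1).Nonempty
  · obtain ⟨v0, hv0, hmin⟩ := (isCompact_sphere (0 : EuclideanSpace ℝ (Fin k)) 1).exists_isMinOn
      hne hcont.continuousOn
    have hv0' : ‖v0‖ = 1 := by simpa using hv0
    refine ⟨φ v0, hpos v0 (by intro h; simp [h] at hv0'), fun v => ?_⟩
    by_cases hv : v = 0
    · simp [hv]
    · have hn : ‖v‖ ≠ 0 := norm_ne_zero_iff.2 hv
      have h1 : φ v0 ≤ φ (‖v‖⁻¹ • v) := hmin (by simp [norm_smul, hn])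
      rw [hhom] at h1
      calc φ v0 * ‖v‖ ^ 2 ≤ (‖v‖⁻¹ ^ 2 * φ v) * ‖v‖ ^ 2 := by gcongr
        _ = φ v := by field_simp
  · refine ⟨1, one_pos, fun v => ?_⟩
    by_cases hv : v = 0
    · simp [hv]
    · exact absurd ⟨‖v‖⁻¹ • v, by simp [norm_smul, hv]⟩ hne

lemma norm_sq_toEuclideanLin {N k : ℕ} (A : Matrix (Fin N) (Fin k) ℝ)
    (v : EuclideanSpace ℝ (Fin k)) :
    ‖Matrix.toEuclideanLin A v‖ ^ 2 = v.ofLp ⬝ᵥ ((Aᵀ * A) *ᵥ v.ofLp) := by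
  rw [norm_sq_eq_dotProduct, ofLp_toEuclideanLin, ← mulVec_mulVec, dotProduct_mulVec v.ofLp Aᵀ,
    vecMul_transpose]

namespace Model

variable {Ω : Type*} [MeasurableSpace Ω] {m : Model Ω}

lemma toEuclideanLin_loading_apply {N : ℕ} (j : Fin m.J) (f : EuclideanSpace ℝ (Fin (m.r j)))
    (i : Fin N) : Matrix.toEuclideanLin (m.loading N j) f i = inner ℝ (m.lam j i) f := by
  change (m.loading N j *ᵥ f.ofLp) i = _
  simp only [loading, mulVec, dotProduct, Matrix.of_apply, PiLp.inner_apply, RCLike.inner_apply,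
    conj_trivial]
  exact Finset.sum_congr rfl fun a _ => mul_comm _ _

lemma norm_toEuclideanLin_loading_le {M : ℝ} (hM : ∀ j i, ‖m.lam j i‖ ≤ M) (N : ℕ) (j : Fin m.J)
    (f : EuclideanSpace ℝ (Fin (m.r j))) :
    ‖Matrix.toEuclideanLin (m.loading N j) f‖ ≤ M * √N * ‖f‖ := by
  have hM0 : 0 ≤ M := (norm_nonneg _).trans (hM j 0)
  refine (sq_le_sq₀ (norm_nonneg _) (by positivity)).1 ?_
  rw [EuclideanSpace.real_norm_sq_eq]
  calc _ ≤ ∑ _i : Fin N, (M * ‖f‖) ^ 2 := by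
        refine Finset.sum_le_sum fun i _ => ?_
        rw [toEuclideanLin_loading_apply, ← sq_abs]
        refine pow_le_pow_left₀ (abs_nonneg _) ?_ 2
        exact (abs_real_inner_le_norm _ _).trans
          (mul_le_mul_of_nonneg_right (hM j i) (norm_nonneg _))
    _ = (M * √N * ‖f‖) ^ 2 := by
        rw [Finset.sum_const, Finset.card_univ, Fintype.card_fin, nsmul_eq_mul, mul_pow, mul_pow,
          mul_pow, Real.sq_sqrt (Nat.cast_nonneg N)]
        ring

lemma exists_eventually_le_norm_loading (h : m.LoadingLimits) (j : Fin m.J) :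
    ∃ c : ℝ, 0 < c ∧ ∀ᶠ N : ℕ in atTop, ∀ f : EuclideanSpace ℝ (Fin (m.r j)),
      c * √N * ‖f‖ ≤ ‖Matrix.toEuclideanLin (m.loading N j) f‖ := by
  obtain ⟨S, hS, hlim⟩ := h.1 j
  obtain ⟨c, hc, hcS⟩ := exists_forall_le_of_posDef hS
  have hδ : 0 < c / (2 * ((m.r j : ℝ) ^ 2 + 1)) := by positivity
  set δ := c / (2 * ((m.r j : ℝ) ^ 2 + 1)) with hδdef
  have hδr : (m.r j : ℝ) ^ 2 * δ ≤ c / 2 := by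
    rw [hδdef, ← mul_div_assoc, div_le_div_iff₀ (by positivity) (by positivity)]
    nlinarith
  refine ⟨√(c / 2), Real.sqrt_pos.2 (by positivity), ?_⟩
  have hent : ∀ᶠ N : ℕ in atTop, ∀ a b,
      |((N : ℝ)⁻¹ • ((m.loading N j)ᵀ * m.loading N j)) a b - S a b| < δ := by
    refine eventually_all.2 fun a => eventually_all.2 fun b => ?_
    have h1 := tendsto_pi_nhds.1 (tendsto_pi_nhds.1 hlim a) b
    simpa [Real.dist_eq] using (Metric.tendsto_nhds.1 h1) δ hδ
  filter_upwards [hent, eventually_gt_atTop 0] with N hN hN0 f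
  have hN0' : (0 : ℝ) < N := by exact_mod_cast hN0
  set D : Matrix (Fin (m.r j)) (Fin (m.r j)) ℝ :=
    (N : ℝ)⁻¹ • ((m.loading N j)ᵀ * m.loading N j) - S with hD
  have hDf : |f.ofLp ⬝ᵥ (D *ᵥ f.ofLp)| ≤ (m.r j : ℝ) ^ 2 * δ * ‖f‖ ^ 2 := by
    have hexp : f.ofLp ⬝ᵥ (D *ᵥ f.ofLp) = ∑ a, ∑ b, f a * (D a b * f b) := by
      simp [dotProduct, mulVec, Finset.mul_sum]
    have hfa : ∀ a, |f a| ≤ ‖f‖ := fun a => by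
      simpa [Real.norm_eq_abs] using PiLp.norm_apply_le f a
    rw [hexp]
    calc _ ≤ ∑ a, |∑ b, f a * (D a b * f b)| := Finset.abs_sum_le_sum_abs _ _
      _ ≤ ∑ a, ∑ b, |f a * (D a b * f b)| :=
          Finset.sum_le_sum fun a _ => Finset.abs_sum_le_sum_abs _ _
      _ ≤ ∑ _a : Fin (m.r j), ∑ _b : Fin (m.r j), ‖f‖ * (δ * ‖f‖) := by
          refine Finset.sum_le_sum fun a _ => Finset.sum_le_sum fun b _ => ?_
          rw [abs_mul, abs_mul]
          have h1 : |D a b| ≤ δ := (hN a b).le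
          gcongr <;> exact hfa _
      _ = _ := by simp; ring
  have hsplit : (N : ℝ)⁻¹ * ‖Matrix.toEuclideanLin (m.loading N j) f‖ ^ 2
      = f.ofLp ⬝ᵥ (S *ᵥ f.ofLp) + f.ofLp ⬝ᵥ (D *ᵥ f.ofLp) := by
    rw [norm_sq_toEuclideanLin, ← dotProduct_add, ← add_mulVec, hD, add_sub_cancel, smul_mulVec,
      dotProduct_smul, smul_eq_mul]
  have h1 := hcS f
  have h2 := (abs_le.1 hDf).1
  have h3 := mul_le_mul_of_nonneg_right hδr (sq_nonneg ‖f‖)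
  have h4 : c / 2 * ‖f‖ ^ 2 ≤ (N : ℝ)⁻¹ * ‖Matrix.toEuclideanLin (m.loading N j) f‖ ^ 2 := by
    rw [hsplit]; linarith
  refine (sq_le_sq₀ (by positivity) (norm_nonneg _)).1 ?_
  rw [mul_pow, mul_pow, Real.sq_sqrt (by positivity), Real.sq_sqrt hN0'.le]
  calc c / 2 * N * ‖f‖ ^ 2 = N * (c / 2 * ‖f‖ ^ 2) := by ring
    _ ≤ N * ((N : ℝ)⁻¹ * ‖Matrix.toEuclideanLin (m.loading N j) f‖ ^ 2) := by gcongr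
    _ = _ := by field_simp

/-- The separation of regimes, as a distance from the loading space of the other regime. -/
lemma sqrt_mul_sqrt_le_of_separated {N : ℕ} (hN : 0 < N) {j k : Fin m.J}
    (hinj : Function.Injective (Matrix.toEuclideanLin (m.loading N k)))
    {f : EuclideanSpace ℝ (Fin (m.r j))} {C : ℝ}
    (h : C ≤ (N : ℝ)⁻¹ * ((fun a => f a) ⬝ᵥ
      (((m.loading N j)ᵀ * annihilator (m.loading N k) * m.loading N j) *ᵥ fun a => f a)))
    (g : EuclideanSpace ℝ (Fin (m.r k))) :
    √C * √N ≤ ‖Matrix.toEuclideanLin (m.loading N j) f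
      - Matrix.toEuclideanLin (m.loading N k) g‖ := by
  have hN' : (0 : ℝ) < N := by exact_mod_cast hN
  have h1 := dotProduct_annihilator_le (m.loading N k)
    (fun v hv => hinj (hv.trans (map_zero _).symm)) (Matrix.toEuclideanLin (m.loading N j) f) g
  have h2 : (fun a => f a) ⬝ᵥ
      (((m.loading N j)ᵀ * annihilator (m.loading N k) * m.loading N j) *ᵥ fun a => f a)
      = (Matrix.toEuclideanLin (m.loading N j) f).ofLp ⬝ᵥ (annihilator (m.loading N k) *ᵥ
        (Matrix.toEuclideanLin (m.loading N j) f).ofLp) := by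
    rw [ofLp_toEuclideanLin, ← mulVec_mulVec, ← mulVec_mulVec, dotProduct_mulVec _ (_ᵀ),
      vecMul_transpose]
  rw [h2] at h
  rw [← Real.sqrt_mul' _ hN'.le, Real.sqrt_le_left (norm_nonneg _)]
  refine le_trans ?_ h1
  rw [← div_eq_inv_mul, le_div_iff₀ hN'] at h
  exact h

/-- Every regime occurs with positive probability, and then the almost sure property `s` holds at
some outcome and time in that regime. -/
lemma exists_state {P : Measure Ω} [IsProbabilityMeasure P] {q0 : Fin m.J → ℝ}
    (h : m.StateFrequencies P q0) {s : Ω → Prop} (hs : ∀ᵐ ω ∂P, s ω) (j : Fin m.J) :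
    ∃ ω t, m.z t ω = j ∧ s ω := by
  have h1 := likely_of_tendstoInMeasure (h j).1 (h j).2.1 (by norm_num : (0 : ℝ) < 1 / 2)
  obtain ⟨T, ω, h2, h3⟩ := h1.exists (by norm_num) hs
  by_contra! hcon
  have h4 : ∀ t, m.ind t j ω = 0 := by
    intro t
    rw [ind, if_neg]
    exact fun hz => hcon ω t hz h3
  simp [h4, abs_of_pos (h j).2.1] at h2

lemma exists_regularLoadings {P : Measure Ω} [IsProbabilityMeasure P] {q0 : Fin m.J → ℝ}
    (hload : m.LoadingLimits) (hsep : m.RegimesSeparated P) (hstate : m.StateFrequencies P q0) :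
    ∃ c K R : ℝ, 0 < c ∧ 0 ≤ K ∧ (∀ j i, ‖m.lam j i‖ ≤ K) ∧ ∀ᶠ N : ℕ in atTop,
      m.RegularLoadings N c K R ∧ ∀ᵐ ω ∂P, ∀ t k, m.z t ω ≠ k → ∀ g,
        c * √N ≤ ‖m.common N t ω - Matrix.toEuclideanLin (m.loading N k) g‖ := by
  choose c0 hc0 hc0' using exists_eventually_le_norm_loading hload
  obtain ⟨C, hC, hsepC⟩ := hsep
  obtain ⟨M, hM⟩ := hload.2
  obtain ⟨c1, hc1, hc1'⟩ := exists_pos_le hc0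
  set c := min c1 √C with hc
  have hcpos : 0 < c := lt_min hc1 (Real.sqrt_pos.2 hC)
  have hM' : ∀ j i, ‖m.lam j i‖ ≤ |M| := fun j i => (hM j i).trans (le_abs_self M)
  have hlow : ∀ᶠ N : ℕ in atTop, ∀ j, ∀ f : EuclideanSpace ℝ (Fin (m.r j)),
      c * √N * ‖f‖ ≤ ‖Matrix.toEuclideanLin (m.loading N j) f‖ := by
    filter_upwards [eventually_all.2 hc0'] with N hN j f
    refine le_trans ?_ (hN j f)
    gcongr
    exact (min_le_left _ _).trans (hc1' j)
  have hsepE : ∀ᶠ N : ℕ in atTop, ∀ᵐ ω ∂P, ∀ j k, j ≠ k → ∀ t, m.z t ω = j →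
      C ≤ (N : ℝ)⁻¹ * ((fun a => m.F t ω j a) ⬝ᵥ
        (((m.loading N j)ᵀ * annihilator (m.loading N k) * m.loading N j) *ᵥ
          (fun a => m.F t ω j a))) := by
    have : ∀ᶠ N : ℕ in atTop, ∀ j k, j ≠ k → ∀ᵐ ω ∂P, ∀ t, m.z t ω = j →
      C ≤ (N : ℝ)⁻¹ * ((fun a => m.F t ω j a) ⬝ᵥ
        (((m.loading N j)ᵀ * annihilator (m.loading N k) * m.loading N j) *ᵥ
          (fun a => m.F t ω j a))) := by
      refine eventually_all.2 fun j => eventually_all.2 fun k => ?_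
      by_cases hjk : j = k
      · exact Eventually.of_forall fun _ h => absurd hjk h
      · filter_upwards [hsepC j k hjk] with N hN _ using hN
    filter_upwards [this] with N hN
    refine ae_all_iff.2 fun j => ae_all_iff.2 fun k => ?_
    by_cases hjk : j = k
    · exact Eventually.of_forall fun _ h => absurd hjk h
    · filter_upwards [hN j k hjk] with ω hω _ using hω
  have hcC : ∀ N : ℕ, c * √N ≤ √C * √N := fun N => by gcongr; exact min_le_right _ _
  have hae : ∀ᶠ N : ℕ in atTop, ∀ᵐ ω ∂P, ∀ t k, m.z t ω ≠ k → ∀ g,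
        c * √N ≤ ‖m.common N t ω - Matrix.toEuclideanLin (m.loading N k) g‖ := by
    filter_upwards [hsepE, hlow, eventually_gt_atTop 0] with N h1 h2 hN
    filter_upwards [h1] with ω hω t k hk g
    exact (hcC N).trans
      (sqrt_mul_sqrt_le_of_separated hN (injective_of_le_norm
        (mul_pos hcpos (Real.sqrt_pos.2 (by exact_mod_cast hN))) (h2 k)) (hω _ k hk t rfl) g)
  -- one factor per regime that is separated for all large sample sizes simultaneously
  obtain ⟨N0, hN0⟩ := eventually_atTop.1 hae
  have hall : ∀ᵐ ω ∂P, ∀ N : ℕ, N0 ≤ N → ∀ t k, m.z t ω ≠ k → ∀ g,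
        c * √N ≤ ‖m.common N t ω - Matrix.toEuclideanLin (m.loading N k) g‖ := by
    refine ae_all_iff.2 fun N => ?_
    by_cases hN : N0 ≤ N
    · filter_upwards [hN0 N hN] with ω hω _ using hω
    · exact Eventually.of_forall fun _ h => absurd h hN
  choose ω0 t0 hz0 hω0 using exists_state hstate hall
  refine ⟨c, |M|, ∑ j, ‖m.F (t0 j) (ω0 j) j‖, hcpos, abs_nonneg M, hM', ?_⟩
  filter_upwards [hlow, hae, eventually_ge_atTop N0] with N h1 h2 hN
  refine ⟨⟨h1, norm_toEuclideanLin_loading_le hM' N, fun j =>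
    ⟨m.F (t0 j) (ω0 j) j, ?_, fun k hk g => ?_⟩⟩, h2⟩
  · exact Finset.single_le_sum (f := fun j => ‖m.F (t0 j) (ω0 j) j‖)
      (fun _ _ => norm_nonneg _) (Finset.mem_univ j)
  · rw [← m.common_eq (hz0 j)]
    exact hω0 j N hN (t0 j) k (by rw [hz0 j]; exact hk) g

end Model

/-! ### Moment bounds in probability -/

section Moments

variable {Ω ι : Type*} [MeasurableSpace Ω] {P : Measure Ω}

lemma expNonneg_mono {X Y : Ω → ℝ} (h : ∀ ω, X ω ≤ Y ω) : expNonneg P X ≤ expNonneg P Y :=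
  lintegral_mono fun ω => ENNReal.ofReal_le_ofReal (h ω)

lemma expNonneg_const_mul {a : ℝ} (ha : 0 ≤ a) (X : Ω → ℝ) (hX : Measurable X) :
    expNonneg P (fun ω => a * X ω) = ENNReal.ofReal a * expNonneg P X := by
  simp only [expNonneg, ENNReal.ofReal_mul ha]
  exact lintegral_const_mul _ hX.ennreal_ofReal

lemma expNonneg_sum_le {κ : Type*} (S : Finset κ) {X : κ → Ω → ℝ} (hX : ∀ s, Measurable (X s))
    (h0 : ∀ s ω, 0 ≤ X s ω) {M : ℝ} (h : ∀ s ∈ S, expNonneg P (X s) ≤ ENNReal.ofReal M) :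
    expNonneg P (fun ω => ∑ s ∈ S, X s ω) ≤ ENNReal.ofReal (S.card * M) := by
  simp only [expNonneg, ENNReal.ofReal_sum_of_nonneg fun s (_ : s ∈ S) => h0 s _]
  rw [lintegral_finsetSum _ fun s _ => (hX s).ennreal_ofReal]
  refine (Finset.sum_le_sum h).trans_eq ?_
  rw [Finset.sum_const, nsmul_eq_mul, ENNReal.ofReal_mul (Nat.cast_nonneg _)]
  simp

/-- The maximum of `ρ` random variables with bounded absolute moments of order `a` is
`O_p(ρ^{1/a})`. -/
lemma exists_measure_max_le {κ : Type*} {a M θ : ℝ} (ha : 1 ≤ a) (hθ : 0 < θ) :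
    ∃ C : ℝ, 1 ≤ C ∧ ∀ (S : Finset κ) (X : κ → Ω → ℝ), (∀ s, Measurable (X s)) →
      (∀ s ω, 0 ≤ X s ω) → (∀ s, expNonneg P (fun ω => X s ω ^ a) ≤ ENNReal.ofReal M) →
      P {ω | ¬ ∀ s ∈ S, X s ω ≤ C * (S.card : ℝ) ^ (1 / a)} ≤ ENNReal.ofReal θ := by
  have ha0 : 0 < a := by linarith
  set C := max 1 (M / θ) with hC
  have hC1 : 1 ≤ C := le_max_left _ _
  have hC0 : 0 < C := by linarith
  have hCa : M ≤ θ * C ^ a := by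
    have h1 : C ≤ C ^ a := by
      simpa using Real.rpow_le_rpow_of_exponent_le hC1 ha
    have h2 : M / θ ≤ C ^ a := (le_max_right _ _).trans h1
    rw [div_le_iff₀ hθ] at h2
    linarith
  refine ⟨C, hC1, fun S X hX h0 hM => ?_⟩
  rcases S.eq_empty_or_nonempty with rfl | hS
  · simp
  have hρ : (0 : ℝ) < S.card := by exact_mod_cast hS.card_pos
  have hsub : {ω | ¬ ∀ s ∈ S, X s ω ≤ C * (S.card : ℝ) ^ (1 / a)}
      ⊆ ⋃ s ∈ S, {ω | ¬ X s ω ^ a ≤ C ^ a * S.card} := by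
    intro ω hω
    have hω' : ¬ ∀ s ∈ S, X s ω ≤ C * (S.card : ℝ) ^ (1 / a) := hω
    push Not at hω'
    obtain ⟨s, hs, hlt⟩ := hω'
    simp only [Set.mem_iUnion]
    refine ⟨s, hs, not_le.2 ?_⟩
    have := Real.rpow_lt_rpow (by positivity) hlt ha0
    rwa [Real.mul_rpow hC0.le (by positivity), ← Real.rpow_mul hρ.le, one_div,
      inv_mul_cancel₀ ha0.ne', Real.rpow_one] at this
  refine (measure_mono hsub).trans ((measure_biUnion_finset_le _ _).trans ?_)
  have hone : ∀ s ∈ S, P {ω | ¬ X s ω ^ a ≤ C ^ a * S.card} ≤ ENNReal.ofReal (θ / S.card) := by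
    intro s _
    refine (measure_not_le_le_of_expNonneg ((hX s).pow_const a) (hM s) (by positivity)).trans
      (ENNReal.ofReal_le_ofReal ?_)
    rw [div_le_div_iff₀ (by positivity) hρ]
    nlinarith
  refine (Finset.sum_le_sum hone).trans_eq ?_
  rw [Finset.sum_const, nsmul_eq_mul, ← ENNReal.ofReal_natCast, ← ENNReal.ofReal_mul hρ.le]
  congr 1
  field_simp

end Moments

namespace Model

variable {Ω : Type*} [MeasurableSpace Ω] (m : Model Ω) {P : Measure Ω}

lemma measurable_ind (t : ℕ) (j : Fin m.J) : Measurable (m.ind t j) :=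
  Measurable.ite (m.measurable_z t (measurableSet_singleton j)) measurable_const measurable_const

lemma measurable_norm_factor (t : ℕ) : Measurable fun ω => ‖m.F t ω (m.z t ω)‖ := by
  have : (fun ω => ‖m.F t ω (m.z t ω)‖) = fun ω => ∑ j, m.ind t j ω * ‖m.F t ω j‖ := by
    funext ω
    simp [ind]
  rw [this]
  exact Finset.measurable_sum _ fun j _ => (m.measurable_ind t j).mul (m.measurable_F t j).norm

lemma measurable_norm_errVec (N t : ℕ) : Measurable fun ω => ‖m.errVec N t ω‖ := by
  have : (fun ω => ‖m.errVec N t ω‖) = fun ω => √(∑ i : Fin N, m.e i t ω ^ 2) := by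
    funext ω
    rw [EuclideanSpace.norm_eq]
    simp [errVec]
  rw [this]
  exact (Finset.measurable_sum _ fun (i : Fin N) _ => (m.measurable_e i t).pow_const 2).sqrt

variable {m}

lemma likely_sum_factor_sq_le [IsProbabilityMeasure P] {α : ℝ} (hα : 2 ≤ α)
    (h : m.FactorMoments P α) {θ : ℝ} (hθ : 0 < θ) :
    ∃ C : ℝ, 0 ≤ C ∧ Likely P atTop θ fun T ω =>
      ∑ t ∈ Finset.range T, ‖m.F t ω (m.z t ω)‖ ^ 2 ≤ T * C := by
  obtain ⟨M, hM⟩ := h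
  have hM1 : 0 < 1 + |M| := by positivity
  have hsq : ∀ t, expNonneg P (fun ω => ‖m.F t ω (m.z t ω)‖ ^ 2) ≤ ENNReal.ofReal (1 + |M|) := by
    intro t
    have hpt : ∀ x : ℝ, 0 ≤ x → x ^ 2 ≤ 1 + x ^ α := by
      intro x hx
      rcases le_total x 1 with h1 | h1
      · have := Real.rpow_nonneg hx α
        nlinarith
      · have := Real.rpow_le_rpow_of_exponent_le h1 hα
        rw [Real.rpow_two] at this
        linarith
    calc _ ≤ expNonneg P (fun ω => 1 + ‖m.F t ω (m.z t ω)‖ ^ α) :=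
          expNonneg_mono fun ω => hpt _ (norm_nonneg _)
      _ = 1 + expNonneg P (fun ω => ‖m.F t ω (m.z t ω)‖ ^ α) := by
          simp only [expNonneg]
          simp_rw [fun ω => ENNReal.ofReal_add zero_le_one
            (Real.rpow_nonneg (norm_nonneg (m.F t ω (m.z t ω))) α)]
          rw [lintegral_add_left measurable_const]
          simp
      _ ≤ 1 + ENNReal.ofReal |M| :=
          add_le_add_right ((hM t).trans (ENNReal.ofReal_le_ofReal (le_abs_self M))) 1
      _ = _ := by rw [ENNReal.ofReal_add zero_le_one (abs_nonneg M), ENNReal.ofReal_one]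
  refine ⟨(1 + |M|) / θ, by positivity, ?_⟩
  filter_upwards [eventually_gt_atTop 0] with T hT
  have hT' : (0 : ℝ) < T := by exact_mod_cast hT
  refine (measure_not_le_le_of_expNonneg
    (Finset.measurable_sum _ fun t _ => (m.measurable_norm_factor t).pow_const 2)
    (expNonneg_sum_le (Finset.range T) (fun t => (m.measurable_norm_factor t).pow_const 2)
      (fun _ _ => sq_nonneg _) fun t _ => hsq t) (by positivity)).trans
    (ENNReal.ofReal_le_ofReal (le_of_eq ?_))
  rw [Finset.card_range]
  field_simp

variable (m) in
/-- `T^{-1/2} ∑_t (e_it e_kt - E e_it e_kt)`. -/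
def covFluct (P : Measure Ω) (T i k : ℕ) (ω : Ω) : ℝ :=
  (√T)⁻¹ * ∑ t ∈ Finset.range T, (m.e i t ω * m.e k t ω - ∫ ω', m.e i t ω' * m.e k t ω' ∂P)

/-- The Frobenius norm of the fluctuation of the empirical second moment matrix of the errors is
`O_p(N / √T)`; the sum over the regimes recovers the unrestricted fluctuation. -/
lemma likely_sum_covFluct_sq_le (h : m.ErrorFluctuation P) {θ : ℝ} (hθ : 0 < θ) :
    ∃ C : ℝ, 0 ≤ C ∧ Likely P (atTop ×ˢ atTop) θ fun (n : ℕ × ℕ) ω =>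
      ∑ i ∈ Finset.range n.1, ∑ k ∈ Finset.range n.1, m.covFluct P n.2 i k ω ^ 2
        ≤ C * (n.1 : ℝ) ^ 2 := by
  obtain ⟨M, hM⟩ := h
  have hM' := fun i k T j => (hM i k T j).trans (ENNReal.ofReal_le_ofReal (le_abs_self M))
  set D : ℕ → ℕ × ℕ × Fin m.J → Ω → ℝ := fun T s ω => ((Real.sqrt T)⁻¹ * ∑ t ∈ Finset.range T,
      (m.e s.1 t ω * m.e s.2.1 t ω - ∫ ω', m.e s.1 t ω' * m.e s.2.1 t ω' ∂P)
        * m.ind t s.2.2 ω) ^ 2 with hD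
  have hDm : ∀ T s, Measurable (D T s) := by
    intro T s
    refine Measurable.pow_const (Measurable.const_mul ?_ _) 2
    exact Finset.measurable_sum _ fun t _ =>
      (((m.measurable_e _ t).mul (m.measurable_e _ t)).sub_const _).mul (m.measurable_ind t _)
  have hle : ∀ (N T : ℕ) ω, ∑ i ∈ Finset.range N, ∑ k ∈ Finset.range N, m.covFluct P T i k ω ^ 2
      ≤ m.J * ∑ s ∈ Finset.range N ×ˢ Finset.range N ×ˢ (Finset.univ : Finset (Fin m.J)),
        D T s ω := by
    intro N T ω
    rw [Finset.sum_product, Finset.mul_sum]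
    refine Finset.sum_le_sum fun i _ => ?_
    rw [Finset.sum_product, Finset.mul_sum]
    refine Finset.sum_le_sum fun k _ => ?_
    have hsplit : m.covFluct P T i k ω = ∑ j, (Real.sqrt T)⁻¹ * ∑ t ∈ Finset.range T,
      (m.e i t ω * m.e k t ω - ∫ ω', m.e i t ω' * m.e k t ω' ∂P) * m.ind t j ω := by
      rw [← Finset.mul_sum, Finset.sum_comm, covFluct]
      congr 1
      refine Finset.sum_congr rfl fun t _ => ?_
      rw [← Finset.mul_sum]
      simp [ind]
    rw [hsplit]
    simpa using sq_sum_le_card_mul_sum_sq (s := (Finset.univ : Finset (Fin m.J)))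
      (f := fun j => (Real.sqrt T)⁻¹ * ∑ t ∈ Finset.range T,
        (m.e i t ω * m.e k t ω - ∫ ω', m.e i t ω' * m.e k t ω' ∂P) * m.ind t j ω)
  -- `J + 1` and `|M| + 1` instead of `J` and `M` keep the constant positive
  refine ⟨(m.J + 1) * ((m.J + 1) * (|M| + 1)) / θ, by positivity, ?_⟩
  filter_upwards [tendsto_fst.eventually (eventually_gt_atTop 0)] with n hn
  have hn' : (0 : ℝ) < n.1 := by exact_mod_cast hn
  set S := Finset.range n.1 ×ˢ Finset.range n.1 ×ˢ (Finset.univ : Finset (Fin m.J)) with hS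
  have hcard : (S.card : ℝ) = n.1 * (n.1 * m.J) := by simp [hS]
  have h1 : expNonneg P (fun ω => ∑ s ∈ S, D n.2 s ω) ≤ ENNReal.ofReal (S.card * |M|) :=
    expNonneg_sum_le S (hDm n.2) (fun _ _ => sq_nonneg _) fun s _ => hM' _ _ _ _
  refine le_trans (measure_mono ?_) ((measure_not_le_le_of_expNonneg
    (Finset.measurable_sum _ fun s _ => hDm n.2 s) h1
    (by positivity : 0 < (m.J + 1) * (|M| + 1) / θ * (n.1 : ℝ) ^ 2)).trans
      (ENNReal.ofReal_le_ofReal ?_))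
  · intro ω hω hcon
    refine hω ((hle _ _ ω).trans ?_)
    calc _ ≤ (m.J : ℝ) * ((m.J + 1) * (|M| + 1) / θ * (n.1 : ℝ) ^ 2) := by gcongr
      _ ≤ ((m.J : ℝ) + 1) * ((m.J + 1) * (|M| + 1) / θ * (n.1 : ℝ) ^ 2) := by gcongr; linarith
      _ = _ := by ring
  · rw [hcard, div_le_iff₀ (by positivity)]
    have : θ * ((m.J + 1) * (|M| + 1) / θ * (n.1 : ℝ) ^ 2)
        = (m.J + 1) * (|M| + 1) * (n.1 : ℝ) ^ 2 := by field_simp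
    rw [this]
    have h3 : (m.J : ℝ) * |M| ≤ (m.J + 1) * (|M| + 1) := by gcongr <;> linarith
    calc (n.1 : ℝ) * (n.1 * m.J) * |M| = (m.J * |M|) * (n.1 : ℝ) ^ 2 := by ring
      _ ≤ _ := by gcongr

/-- The empirical second moment matrix of the errors has bounded operator norm up to its
fluctuation, because the rows of its expectation are absolutely summable. -/
lemma sum_inner_errVec_sq_le {M C : ℝ} {τ : ℕ → ℕ → ℝ}
    (hτ : ∀ i k t, |∫ ω, m.e i t ω * m.e k t ω ∂P| ≤ τ i k)
    (hM : ∀ i N : ℕ, ∑ k ∈ Finset.range N, τ i k ≤ M) (hC : 0 ≤ C) {N T : ℕ} (hT : 0 < T) {ω : Ω}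
    (h : ∑ i ∈ Finset.range N, ∑ k ∈ Finset.range N, m.covFluct P T i k ω ^ 2 ≤ C * (N : ℝ) ^ 2)
    (v : EuclideanSpace ℝ (Fin N)) :
    ∑ t ∈ Finset.range T, (inner ℝ v (m.errVec N t ω)) ^ 2
      ≤ T * (M + √C * N / √T) * ‖v‖ ^ 2 := by
  have hT' : (0 : ℝ) < T := by exact_mod_cast hT
  have hsT : 0 < √(T : ℝ) := Real.sqrt_pos.2 hT'
  have hv : ‖v‖ ^ 2 = ∑ i, v i ^ 2 := EuclideanSpace.real_norm_sq_eq v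
  set μ : ℕ → Fin N → Fin N → ℝ := fun t i k => ∫ ω', m.e i t ω' * m.e k t ω' ∂P with hμ
  have hμs : ∀ t i k, μ t i k = μ t k i := fun t i k => by simp only [hμ, mul_comm]
  have hrow : ∀ t i, ∑ k, |μ t i k| ≤ M := by
    intro t i
    refine (Finset.sum_le_sum fun (k : Fin N) _ => hτ i k t).trans ?_
    rw [← Finset.sum_range fun k => τ i k]
    exact hM i N
  have hmean : ∀ t, ∑ i, ∑ k, v i * v k * μ t i k ≤ M * ‖v‖ ^ 2 := by
    intro t
    have h1 : ∀ i k, v i * v k * μ t i k ≤ v i ^ 2 * |μ t i k| / 2 + v k ^ 2 * |μ t k i| / 2 := by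
      intro i k
      rw [hμs t k i]
      have e1 : v i * v k * μ t i k ≤ |v i| * |v k| * |μ t i k| := by
        rw [← abs_mul, ← abs_mul]; exact le_abs_self _
      have e2 : |v i| * |v k| ≤ (v i ^ 2 + v k ^ 2) / 2 := by
        nlinarith [sq_nonneg (|v i| - |v k|), sq_abs (v i), sq_abs (v k)]
      have e3 := mul_le_mul_of_nonneg_right e2 (abs_nonneg (μ t i k))
      linarith
    have h2 : ∑ i, ∑ k, v i ^ 2 * |μ t i k| ≤ M * ‖v‖ ^ 2 := by
      rw [hv, Finset.mul_sum]
      refine Finset.sum_le_sum fun i _ => ?_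
      rw [← Finset.mul_sum, mul_comm]
      exact mul_le_mul_of_nonneg_right (hrow t i) (sq_nonneg _)
    calc _ ≤ ∑ i, ∑ k, (v i ^ 2 * |μ t i k| / 2 + v k ^ 2 * |μ t k i| / 2) :=
          Finset.sum_le_sum fun i _ => Finset.sum_le_sum fun k _ => h1 i k
      _ = (∑ i, ∑ k, v i ^ 2 * |μ t i k|) / 2 + (∑ k, ∑ i, v k ^ 2 * |μ t k i|) / 2 := by
          simp only [Finset.sum_add_distrib, Finset.sum_div]
          congr 1
          exact Finset.sum_comm
      _ ≤ _ := by linarith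
  have hflu : ∑ i : Fin N, ∑ k : Fin N, v i * v k * m.covFluct P T i k ω
      ≤ √C * N * ‖v‖ ^ 2 := by
    have h1 := Finset.sum_mul_sq_le_sq_mul_sq (Finset.univ : Finset (Fin N × Fin N))
      (fun x => v x.1 * v x.2) (fun x => m.covFluct P T x.1 x.2 ω)
    have e1 : ∑ x : Fin N × Fin N, (v x.1 * v x.2) ^ 2 = (‖v‖ ^ 2) ^ 2 := by
      rw [Fintype.sum_prod_type, hv, sq (∑ i, v i ^ 2), Finset.sum_mul_sum]
      simp only [mul_pow]
    have e2 : ∑ x : Fin N × Fin N, m.covFluct P T x.1 x.2 ω ^ 2 ≤ C * (N : ℝ) ^ 2 := by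
      rw [Fintype.sum_prod_type]
      refine le_trans (le_of_eq ?_) h
      rw [Finset.sum_range]
      exact Finset.sum_congr rfl fun i _ =>
        (Finset.sum_range fun k => m.covFluct P T i k ω ^ 2).symm
    rw [Fintype.sum_prod_type, e1] at h1
    refine le_of_sq_le_sq ?_ (by positivity)
    calc _ ≤ (‖v‖ ^ 2) ^ 2 * (C * (N : ℝ) ^ 2) :=
          h1.trans (mul_le_mul_of_nonneg_left e2 (by positivity))
      _ = (√C * N * ‖v‖ ^ 2) ^ 2 := by rw [mul_pow, mul_pow, Real.sq_sqrt hC]; ring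
  have hexp : ∑ t ∈ Finset.range T, (inner ℝ v (m.errVec N t ω)) ^ 2
      = √T * ∑ i : Fin N, ∑ k : Fin N, v i * v k * m.covFluct P T i k ω
        + ∑ t ∈ Finset.range T, ∑ i, ∑ k, v i * v k * μ t i k := by
    have e1 : ∀ t, (inner ℝ v (m.errVec N t ω)) ^ 2
        = ∑ i : Fin N, ∑ k : Fin N, v i * v k * (m.e i t ω * m.e k t ω) := by
      intro t
      have : inner ℝ v (m.errVec N t ω) = ∑ i : Fin N, v i * m.e i t ω := by
        simp only [errVec, PiLp.inner_apply, RCLike.inner_apply, conj_trivial]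
        exact Finset.sum_congr rfl fun _ _ => mul_comm _ _
      rw [this, sq, Finset.sum_mul_sum]
      exact Finset.sum_congr rfl fun i _ => Finset.sum_congr rfl fun k _ => by ring
    have e2 : ∀ i k : Fin N, √T * (v i * v k * m.covFluct P T i k ω)
        = ∑ t ∈ Finset.range T, v i * v k * (m.e i t ω * m.e k t ω - μ t i k) := by
      intro i k
      rw [covFluct, ← Finset.mul_sum]
      field_simp
      rfl
    simp_rw [e1, Finset.mul_sum, e2]
    have e3 : ∑ i : Fin N, ∑ k : Fin N, ∑ t ∈ Finset.range T,
          v i * v k * (m.e i t ω * m.e k t ω - μ t i k)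
        = ∑ t ∈ Finset.range T, ∑ i : Fin N, ∑ k : Fin N,
          v i * v k * (m.e i t ω * m.e k t ω - μ t i k) := by
      rw [Finset.sum_comm (s := Finset.range T)]
      exact Finset.sum_congr rfl fun i _ => Finset.sum_comm
    rw [e3, ← Finset.sum_add_distrib]
    refine Finset.sum_congr rfl fun t _ => ?_
    rw [← Finset.sum_add_distrib]
    refine Finset.sum_congr rfl fun i _ => ?_
    rw [← Finset.sum_add_distrib]
    exact Finset.sum_congr rfl fun k _ => by ring
  have h5 : ∑ t ∈ Finset.range T, ∑ i, ∑ k, v i * v k * μ t i k ≤ T * (M * ‖v‖ ^ 2) := by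
    refine (Finset.sum_le_sum fun t _ => hmean t).trans_eq ?_
    simp
  have h6 := mul_le_mul_of_nonneg_left hflu hsT.le
  have h7 : T * (M + √C * N / √T) * ‖v‖ ^ 2
      = √T * (√C * N * ‖v‖ ^ 2) + T * (M * ‖v‖ ^ 2) := by
    have : (T : ℝ) = √T * √T := (Real.mul_self_sqrt hT'.le).symm
    have h8 : (T : ℝ) * (√C * N / √T) = √T * (√C * N) := by
      rw [mul_div_assoc', div_eq_iff hsT.ne']
      nth_rewrite 1 [this]
      ring
    linear_combination ‖v‖ ^ 2 * h8
  rw [hexp, h7]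
  linarith

lemma expNonneg_norm_errVec_le {α M : ℝ} (hα : 2 ≤ α)
    (h : ∀ i t, expNonneg P (fun ω => |m.e i t ω| ^ α) ≤ ENNReal.ofReal M) {N : ℕ} (hN : 0 < N)
    (t : ℕ) : expNonneg P (fun ω => (‖m.errVec N t ω‖ / √N) ^ α) ≤ ENNReal.ofReal M := by
  have hN' : (0 : ℝ) < N := by exact_mod_cast hN
  -- convexity of `x ↦ x ^ (α / 2)`
  have hpt : ∀ ω, (‖m.errVec N t ω‖ / √N) ^ α ≤ (N : ℝ)⁻¹ * ∑ i : Fin N, |m.e i t ω| ^ α := by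
    intro ω
    have h1 := Real.rpow_arith_mean_le_arith_mean_rpow (Finset.univ : Finset (Fin N))
      (fun _ => (N : ℝ)⁻¹) (fun i => m.e i t ω ^ 2) (fun _ _ => by positivity) (by simp; field_simp)
      (fun _ _ => sq_nonneg _) (by linarith : 1 ≤ α / 2)
    have h2 : ∑ i : Fin N, (N : ℝ)⁻¹ * m.e i t ω ^ 2 = (‖m.errVec N t ω‖ / √N) ^ (2 : ℝ) := by
      rw [Real.rpow_two, div_pow, Real.sq_sqrt hN'.le, EuclideanSpace.real_norm_sq_eq,
        ← Finset.mul_sum, div_eq_inv_mul]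
      rfl
    have h3 : ∀ x : ℝ, (x ^ 2) ^ (α / 2) = |x| ^ α := by
      intro x
      rw [← sq_abs, ← Real.rpow_two, ← Real.rpow_mul (abs_nonneg x)]
      congr 1
      ring
    rw [h2, ← Real.rpow_mul (by positivity), mul_div_cancel₀ _ (two_ne_zero)] at h1
    refine h1.trans_eq ?_
    simp_rw [h3, ← Finset.mul_sum]
  have hm : ∀ i : Fin N, Measurable fun ω => |m.e i t ω| ^ α := fun i =>
    ((m.measurable_e i t).abs).pow_const α
  refine (expNonneg_mono hpt).trans ?_
  rw [expNonneg_const_mul (by positivity) _ (Finset.measurable_sum _ fun i _ => hm i)]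
  refine (mul_le_mul_right (expNonneg_sum_le Finset.univ hm
    (fun _ _ => Real.rpow_nonneg (abs_nonneg _) _) fun i _ => h i t) _).trans_eq ?_
  rw [← ENNReal.ofReal_mul (by positivity)]
  congr 1
  rw [Finset.card_univ, Fintype.card_fin]
  field_simp

lemma abs_inner_errVec_loading_le {N t : ℕ} {ω : Ω} (hN : 0 < N) (j : Fin m.J)
    (f : EuclideanSpace ℝ (Fin (m.r j))) :
    |inner ℝ (m.errVec N t ω) (Matrix.toEuclideanLin (m.loading N j) f)|
      ≤ √N * ‖(Real.sqrt N)⁻¹ • ∑ i ∈ Finset.range N, m.e i t ω • m.lam j i‖ * ‖f‖ := by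
  have hs : 0 < √(N : ℝ) := Real.sqrt_pos.2 (by exact_mod_cast hN)
  have h1 : inner ℝ (m.errVec N t ω) (Matrix.toEuclideanLin (m.loading N j) f)
      = inner ℝ (∑ i ∈ Finset.range N, m.e i t ω • m.lam j i) f := by
    rw [sum_inner, Finset.sum_range]
    simp only [real_inner_smul_left, ← toEuclideanLin_loading_apply (N := N)]
    rw [PiLp.inner_apply]
    refine Finset.sum_congr rfl fun i _ => ?_
    simp [errVec, mul_comm]
  rw [h1, norm_smul, Real.norm_eq_abs, abs_of_pos (inv_pos.2 hs), ← mul_assoc,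
    mul_inv_cancel₀ hs.ne', one_mul]
  exact abs_real_inner_le_norm _ _

lemma measurable_norm_loading_error (N t : ℕ) (j : Fin m.J) : Measurable fun ω =>
    ‖(Real.sqrt N)⁻¹ • ∑ i ∈ Finset.range N, m.e i t ω • m.lam j i‖ := by
  have h : ∀ i, Measurable (m.e i t) := fun i => m.measurable_e i t
  fun_prop

end Model

/-! ### The rate of the estimated loadings -/

/-- The rate at which the estimated loading spaces are shown to converge. It is slower than the
actual rate, so that it absorbs all constants. -/
def rate (n : ℕ × ℕ) : ℝ := (n.1 : ℝ) ^ (-(1 / 4) : ℝ) + (n.2 : ℝ) ^ (-(1 / 8) : ℝ)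

lemma rate_nonneg (n : ℕ × ℕ) : 0 ≤ rate n := by
  unfold rate; positivity

lemma tendsto_natCast_rpow_neg {a : ℝ} (ha : 0 < a) :
    Tendsto (fun n : ℕ => (n : ℝ) ^ (-a)) atTop (𝓝 0) :=
  (tendsto_rpow_neg_atTop ha).comp tendsto_natCast_atTop_atTop

lemma tendsto_rate : Tendsto rate (atTop ×ˢ atTop) (𝓝 0) := by
  have h1 := (tendsto_natCast_rpow_neg (by norm_num : (0 : ℝ) < 1 / 4)).comp
    (tendsto_fst (f := (atTop : Filter ℕ)) (g := (atTop : Filter ℕ)))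
  have h2 := (tendsto_natCast_rpow_neg (by norm_num : (0 : ℝ) < 1 / 8)).comp
    (tendsto_snd (f := (atTop : Filter ℕ)) (g := (atTop : Filter ℕ)))
  rw [← add_zero (0 : ℝ)]
  exact h1.add h2

/-- The bound on the average excess cost, of order `log N + N / √T`, is eventually dominated by
`N · rate²`. -/
lemma eventually_le_rate (h0 h1 h3 : ℝ) {h2 a : ℝ} (hh2 : 0 ≤ h2) (ha : 0 < a) :
    ∀ᶠ n : ℕ × ℕ in atTop ×ˢ atTop,
      h0 + h1 * Real.log (1 + h2 * n.1) + h3 * (n.1 / √n.2) ≤ a * (n.1 * rate n ^ 2) := by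
  have hN : ∀ᶠ N : ℕ in atTop, h0 + h1 * Real.log (1 + h2 * N) ≤ a * (N : ℝ) ^ (1 / 2 : ℝ) := by
    set b := |h0| + |h1| * Real.log (1 + h2) with hb
    have hlog := (isLittleO_log_rpow_atTop (by norm_num : (0 : ℝ) < 1 / 2)).def
      (by positivity : 0 < a / (2 * (|h1| + 1)))
    have hconst : ∀ᶠ x : ℝ in atTop, b / (a / 2) ≤ x ^ (1 / 2 : ℝ) :=
      (tendsto_rpow_atTop (by norm_num : (0 : ℝ) < 1 / 2)).eventually_ge_atTop _
    filter_upwards [tendsto_natCast_atTop_atTop.eventually hlog,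
      tendsto_natCast_atTop_atTop.eventually hconst, eventually_ge_atTop 1] with N e1 e2 hN
    have hN' : (1 : ℝ) ≤ N := by exact_mod_cast hN
    rw [Real.norm_of_nonneg (Real.log_nonneg hN'), Real.norm_of_nonneg (by positivity)] at e1
    rw [div_le_iff₀ (by positivity)] at e2
    have e3 : Real.log (1 + h2 * N) ≤ Real.log (1 + h2) + Real.log N := by
      rw [← Real.log_mul (by positivity) (by positivity)]
      refine Real.log_le_log (by positivity) ?_
      nlinarith
    have e4 : 0 ≤ Real.log (1 + h2 * N) := Real.log_nonneg (by nlinarith)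
    have e5 : |h1| * Real.log N ≤ a / 2 * (N : ℝ) ^ (1 / 2 : ℝ) := by
      calc |h1| * Real.log N ≤ (|h1| + 1) * (a / (2 * (|h1| + 1)) * (N : ℝ) ^ (1 / 2 : ℝ)) := by
            gcongr
            linarith
        _ = _ := by field_simp
    calc h0 + h1 * Real.log (1 + h2 * N) ≤ |h0| + |h1| * Real.log (1 + h2 * N) := by
          gcongr <;> exact le_abs_self _
      _ ≤ |h0| + |h1| * (Real.log (1 + h2) + Real.log N) := by gcongr
      _ ≤ _ := by linarith
  have hT : ∀ᶠ T : ℕ in atTop, h3 / √(T : ℝ) ≤ a * (T : ℝ) ^ (-(1 / 4) : ℝ) := by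
    have hconst : ∀ᶠ x : ℝ in atTop, h3 / a ≤ x ^ (1 / 4 : ℝ) :=
      (tendsto_rpow_atTop (by norm_num : (0 : ℝ) < 1 / 4)).eventually_ge_atTop _
    filter_upwards [tendsto_natCast_atTop_atTop.eventually hconst, eventually_ge_atTop 1]
      with T e1 hT
    have hT' : (0 : ℝ) < T := by exact_mod_cast hT
    rw [div_le_iff₀ ha] at e1
    rw [Real.sqrt_eq_rpow, div_le_iff₀ (by positivity), mul_assoc, ← Real.rpow_add hT']
    norm_num
    linarith
  filter_upwards [tendsto_fst.eventually hN, tendsto_snd.eventually hT,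
    tendsto_fst.eventually (eventually_ge_atTop 1)] with n e1 e2 hn
  have hn' : (0 : ℝ) < n.1 := by exact_mod_cast hn
  have e3 : (n.1 : ℝ) ^ (-(1 / 2) : ℝ) + (n.2 : ℝ) ^ (-(1 / 4) : ℝ) ≤ rate n ^ 2 := by
    have x1 : ((n.1 : ℝ) ^ (-(1 / 4) : ℝ)) ^ 2 = (n.1 : ℝ) ^ (-(1 / 2) : ℝ) := by
      rw [← Real.rpow_natCast, ← Real.rpow_mul hn'.le]; norm_num
    have x2 : ((n.2 : ℝ) ^ (-(1 / 8) : ℝ)) ^ 2 = (n.2 : ℝ) ^ (-(1 / 4) : ℝ) := by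
      rw [← Real.rpow_natCast, ← Real.rpow_mul (Nat.cast_nonneg _)]; norm_num
    rw [rate, add_sq, x1, x2]
    have : 0 ≤ 2 * (n.1 : ℝ) ^ (-(1 / 4) : ℝ) * (n.2 : ℝ) ^ (-(1 / 8) : ℝ) := by positivity
    linarith
  have e4 : (n.1 : ℝ) * (n.1 : ℝ) ^ (-(1 / 2) : ℝ) = (n.1 : ℝ) ^ (1 / 2 : ℝ) := by
    nth_rewrite 1 [← Real.rpow_one (n.1 : ℝ)]
    rw [← Real.rpow_add hn']; norm_num
  have e5 := mul_le_mul_of_nonneg_left e2 hn'.le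
  have e6 := mul_le_mul_of_nonneg_left e3 (by positivity : 0 ≤ a * n.1)
  have e7 : h3 * (n.1 / √n.2) = n.1 * (h3 / √n.2) := by ring
  rw [e7]
  calc _ ≤ a * (n.1 : ℝ) ^ (1 / 2 : ℝ) + n.1 * (a * (n.2 : ℝ) ^ (-(1 / 4) : ℝ)) := add_le_add e1 e5
    _ = a * n.1 * ((n.1 : ℝ) ^ (-(1 / 2) : ℝ) + (n.2 : ℝ) ^ (-(1 / 4) : ℝ)) := by
        rw [← e4]; ring
    _ ≤ a * n.1 * rate n ^ 2 := e6
    _ = _ := by ring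

namespace Model

variable {Ω : Type*} [MeasurableSpace Ω] {m : Model Ω} {P : Measure Ω}

/-- A relabeling under which every true regime is fitted at the given rate. -/
def GoodPerm (E : m.Estimator) (N T : ℕ) (ω : Ω) (π : Equiv.Perm (Fin m.J)) : Prop :=
  (∀ j, m.r (π j) = m.r j) ∧
    ∀ j, m.Fits (E.Lhat N T ω) (E.s2 N T ω) (rate (N, T)) j (π j)

lemma logDetExcess_loading_le {K C s2 : ℝ} (hK : ∀ j i, ‖m.lam j i‖ ≤ K) (hs : 0 < s2)
    (hC : s2⁻¹ ≤ C) (N : ℕ) (j : Fin m.J) :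
    logDetExcess (m.loading N j) s2
      ≤ ∑ j, Real.log (m.r j).factorial + (∑ j, (m.r j : ℝ)) * Real.log (1 + C * K ^ 2 * N) := by
  have hC0 : 0 < C := (inv_pos.2 hs).trans_le hC
  have hL : 0 ≤ Real.log (1 + C * K ^ 2 * N) :=
    Real.log_nonneg (le_add_of_nonneg_right (by positivity))
  refine (logDetExcess_le (m.loading N j) hs (K := K) fun i a => ?_).trans (add_le_add ?_ ?_)
  · exact (PiLp.norm_apply_le (m.lam j i) a).trans (hK j i)
  · exact Finset.single_le_sum (f := fun j => Real.log (m.r j).factorial)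
      (fun j _ => Real.log_natCast_nonneg _) (Finset.mem_univ j)
  · refine (mul_le_mul_of_nonneg_left (Real.log_le_log (by positivity) ?_)
      (Nat.cast_nonneg _)).trans (mul_le_mul_of_nonneg_right
        (Finset.single_le_sum (f := fun j => (m.r j : ℝ)) (fun _ _ => Nat.cast_nonneg _)
          (Finset.mem_univ j)) hL)
    have : s2⁻¹ * (N * K ^ 2) ≤ C * (N * K ^ 2) := by gcongr
    linarith

/-- With probability approaching one, the estimated regimes are a relabeling of the true ones. -/
lemma likely_exists_goodPerm [IsProbabilityMeasure P] {q0 : Fin m.J → ℝ} {α : ℝ} (hα : 2 ≤ α)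
    (h_factor_second : m.FactorSecondMoments P q0) (h_factor_moments : m.FactorMoments P α)
    (h_loadings : m.LoadingLimits) (h_separated : m.RegimesSeparated P)
    (h_error_cross : m.ErrorCrossSection P) (h_error_fluct : m.ErrorFluctuation P)
    (h_state : m.StateFrequencies P q0) {E : m.Estimator} (hE : E.IsQML P) {θ : ℝ} (hθ : 0 < θ) :
    Likely P (atTop ×ˢ atTop) θ fun (n : ℕ × ℕ) ω => ∃ π, GoodPerm E n.1 n.2 ω π := by
  obtain ⟨c, K, R, hc, hK, hKlam, hreg⟩ := exists_regularLoadings h_loadings h_separated h_state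
  obtain ⟨M, τ, -, hτ, hM⟩ := h_error_cross
  have hM0 : 0 ≤ M := by simpa using hM 0 0
  have hJ : 0 < m.J := by
    obtain ⟨ω⟩ : Nonempty Ω := nonempty_of_isProbabilityMeasure P
    exact (Nat.zero_le _).trans_lt (m.z 0 ω).2
  have hJ' : (0 : ℝ) < m.J := by exact_mod_cast hJ
  -- four global events and two events per regime share the probability `θ`
  set δ := θ / (4 + 2 * m.J) with hδ
  have hδ0 : 0 < δ := by positivity
  obtain ⟨Cs, hCs, hs2⟩ := hE.s2_bounded δ hδ0
  obtain ⟨cq, hcq, hq⟩ := hE.q_bounded δ hδ0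
  obtain ⟨Cf, hCf, hf⟩ := likely_sum_factor_sq_le hα h_factor_moments hδ0
  obtain ⟨Cc, hCc, hcov⟩ := likely_sum_covFluct_sq_le h_error_fluct hδ0
  have hcount : Likely P atTop (m.J * δ) fun (T : ℕ) ω => ∀ j,
      |(T : ℝ)⁻¹ * ∑ t ∈ Finset.range T, m.ind t j ω - q0 j| < q0 j / 2 := by
    simpa using Likely.forall fun j => likely_of_tendstoInMeasure (h_state j).1
      (half_pos (h_state j).2.1) hδ0
  choose κ hκ hnd using fun j => h_factor_second.2 j (1 / (2 * m.J)) (by positivity)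
  have hnd' := Likely.forall fun j => likely_of_tendsto (hnd j) hδ0
  rw [Fintype.card_fin] at hnd'
  have hJC : 0 < 2 * (m.J : ℝ) * (1 + 2 * Cs) := by positivity
  obtain ⟨a, ha, ha'⟩ := exists_pos_le (c := fun j =>
    min (q0 j / (2 * m.J)) (κ j * q0 j / (2 * m.J * (1 + 2 * Cs)))) (fun j => by
      have := (h_state j).2.1
      have := hκ j
      positivity)
  set D : ℝ := ((∑ j, ∑ l, (m.r j + m.r l) : ℕ) : ℝ) with hD
  have hD0 : 0 ≤ D := by positivity
  have hrate := eventually_le_rate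
    (∑ j, Real.log (m.r j).factorial + Cf - 2 * Real.log cq + 2 * D * M * Cs)
    (∑ j, (m.r j : ℝ)) (2 * D * √Cc * Cs) (h2 := Cs * K ^ 2) (by positivity) ha
  have hall := (((((show Likely P _ δ _ from hs2).and (show Likely P _ δ _ from hq) hδ0.le hδ0.le).and
    (hf.comp_tendsto tendsto_snd) (by positivity) hδ0.le).and hcov (by positivity) hδ0.le).and
    (hcount.comp_tendsto tendsto_snd) (by positivity) (by positivity)).and
    (hnd'.comp_tendsto tendsto_snd) (by positivity) (by positivity)
  refine (hall.mono ?_).weaken (le_of_eq (by rw [hδ]; field_simp; ring))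
  have hsmall : ∀ᶠ n in atTop ×ˢ atTop, rate n * R * (1 + 2 * (K + 1) / c) < c := by
    have := (tendsto_rate.mul_const R).mul_const (1 + 2 * (K + 1) / c)
    simp only [zero_mul] at this
    exact this.eventually (gt_mem_nhds hc)
  filter_upwards [hrate, hsmall, tendsto_rate.eventually (ge_mem_nhds one_pos),
    tendsto_rate.eventually (ge_mem_nhds (half_pos hc)), tendsto_fst.eventually hreg,
    tendsto_fst.eventually (eventually_gt_atTop 0),
    tendsto_snd.eventually (eventually_gt_atTop 0)] with n hn hn1 hn2 hn3 hn4 hN hT ω hω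
  obtain ⟨⟨⟨⟨⟨⟨hs_lo, hs_hi⟩, hqω⟩, hfω⟩, hcω⟩, hcnt⟩, hndω⟩ := hω
  have hT' : (0 : ℝ) < n.2 := by exact_mod_cast hT
  have hs := hE.s2_pos n.1 n.2 ω
  have hsinv : (E.s2 n.1 n.2 ω)⁻¹ ≤ Cs := inv_le_of_inv_le₀ hCs hs_lo
  have hb0 : 0 ≤ M + √Cc * n.1 / √n.2 := by positivity
  obtain ⟨k, g, hkg⟩ := sum_excess_le (hE.maximizes n.1 n.2 ω (m.loading n.1)) hs
    (hE.q_pos n.1 n.2 ω) (hE.q_sum n.1 n.2 ω) hcq hqω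
    (fun j => logDetExcess_loading_le hKlam hs hsinv n.1 j) hfω hb0
    (sum_inner_errVec_sq_le hτ hM hCc hT hcω)
  have hH : (∑ j, Real.log (m.r j).factorial
        + (∑ j, (m.r j : ℝ)) * Real.log (1 + Cs * K ^ 2 * n.1)) + Cf - 2 * Real.log cq
        + 2 * D * (M + √Cc * n.1 / √n.2) / E.s2 n.1 n.2 ω ≤ a * (n.1 * rate n ^ 2) := by
    refine le_trans ?_ hn
    have : 2 * D * (M + √Cc * n.1 / √n.2) / E.s2 n.1 n.2 ω
        ≤ 2 * D * (M + √Cc * n.1 / √n.2) * Cs := by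
      rw [div_eq_mul_inv]
      gcongr
    have e : 2 * D * (M + √Cc * n.1 / √n.2) * Cs
        = 2 * D * M * Cs + 2 * D * √Cc * Cs * (n.1 / √n.2) := by ring
    linarith
  have hkg' := hkg.trans (mul_le_mul_of_nonneg_left hH hT'.le)
  have hfits : ∀ j, ∃ k, m.Fits (E.Lhat n.1 n.2 ω) (E.s2 n.1 n.2 ω) (rate n) j k := by
    intro j
    have hq0 := (h_state j).2.1
    have haj := ha' j
    have h1 : a * (2 * m.J) ≤ q0 j := by
      have := haj.trans (min_le_left _ _)
      rwa [le_div_iff₀ (by positivity)] at this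
    have h2 : a * (2 * m.J * (1 + 2 * Cs)) ≤ κ j * q0 j := by
      have := haj.trans (min_le_right _ _)
      rwa [le_div_iff₀ hJC] at this
    refine exists_fits hs hT hkg' hq0 (hκ j) (rate_nonneg n) hs_hi ?_ (hndω j) ?_ ?_
    · have := (abs_lt.1 (hcnt j)).1
      have h3 : q0 j / 2 ≤ (n.2 : ℝ)⁻¹ * ∑ t ∈ Finset.range n.2, m.ind t j ω := by linarith
      rw [← div_eq_inv_mul, le_div_iff₀ hT'] at h3
      linarith
    · have := mul_le_mul_of_nonneg_right h1 (by positivity : 0 ≤ n.1 * rate n ^ 2)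
      linarith
    · have := mul_le_mul_of_nonneg_right h2 (by positivity : 0 ≤ n.1 * rate n ^ 2)
      linarith
  choose σ hσ using hfits
  obtain ⟨hbij, hr⟩ := hn4.1.bijective hc hK hN (rate_nonneg n) hn2 hn3 hn1 hσ
  exact ⟨Equiv.ofBijective σ hbij, hr, hσ⟩

end Model

/-! ### Convergence of the posterior probabilities -/

/-- The first growth condition makes the loading error negligible against the squared maximum of the
factors and errors over `ρ` times; the second summand of the rate uses `ρ ≤ T` only. -/
lemma tendsto_rate_mul_rpow {ι : Type*} {l : Filter ι} {N T ρ : ι → ℕ} (hT : Tendsto T l atTop)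
    (hρ : ∀ᶠ n in l, 1 ≤ ρ n ∧ ρ n ≤ T n) {α : ℝ} (hα : 16 < α)
    (h : Tendsto (fun n => (ρ n : ℝ) ^ (16 / α) / (N n : ℝ)) l (𝓝 0)) :
    Tendsto (fun n => rate (N n, T n) * (ρ n : ℝ) ^ (2 / α)) l (𝓝 0) := by
  have hα0 : 0 < α := by linarith
  have h1 : Tendsto (fun n => ((ρ n : ℝ) ^ (16 / α) / (N n : ℝ)) ^ (1 / 4 : ℝ)) l (𝓝 0) := by
    simpa using h.rpow_const (p := 1 / 4) (Or.inr (by norm_num))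
  have hexp : 0 < 1 / 8 - 2 / α := by
    rw [sub_pos, div_lt_div_iff₀ hα0 (by norm_num)]; linarith
  have h2 := (tendsto_natCast_rpow_neg hexp).comp hT
  have h12 := h1.add h2
  rw [add_zero] at h12
  refine squeeze_zero' (Eventually.of_forall fun n =>
    mul_nonneg (rate_nonneg _) (by positivity)) ?_ h12
  filter_upwards [hρ] with n hn
  have hρ1 : (1 : ℝ) ≤ ρ n := by exact_mod_cast hn.1
  have hρT : (ρ n : ℝ) ≤ T n := by exact_mod_cast hn.2
  have hT0 : (0 : ℝ) < T n := by linarith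
  have e1 : (N n : ℝ) ^ (-(1 / 4) : ℝ) * (ρ n : ℝ) ^ (2 / α)
      ≤ ((ρ n : ℝ) ^ (16 / α) / (N n : ℝ)) ^ (1 / 4 : ℝ) := by
    rw [Real.div_rpow (by positivity) (by positivity), ← Real.rpow_mul (by positivity),
      div_eq_mul_inv (_ ^ _ : ℝ), ← Real.rpow_neg (by positivity),
      mul_comm _ ((N n : ℝ) ^ (-(1 / 4) : ℝ))]
    refine mul_le_mul_of_nonneg_left (Real.rpow_le_rpow_of_exponent_le hρ1 ?_) (by positivity)
    rw [div_mul_div_comm, div_le_div_iff₀ hα0 (by positivity)]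
    linarith
  have e2 : (T n : ℝ) ^ (-(1 / 8) : ℝ) * (ρ n : ℝ) ^ (2 / α)
      ≤ (T n : ℝ) ^ (-(1 / 8 - 2 / α)) := by
    rw [neg_sub, sub_eq_add_neg, add_comm, Real.rpow_add hT0]
    gcongr
  rw [rate, add_mul]
  exact add_le_add e1 e2

lemma tendsto_rpow_div_sqrt {ι : Type*} {l : Filter ι} {N ρ : ι → ℕ} {α β : ℝ}
    (h : Tendsto (fun n => (ρ n : ℝ) ^ (2 / α + 2 / β) / (N n : ℝ)) l (𝓝 0)) :
    Tendsto (fun n => (ρ n : ℝ) ^ (1 / α + 1 / β) / √(N n : ℝ)) l (𝓝 0) := by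
  have h1 := h.sqrt
  rw [Real.sqrt_zero] at h1
  refine h1.congr fun n => ?_
  rw [Real.sqrt_div (by positivity), Real.sqrt_eq_rpow, ← Real.rpow_mul (by positivity)]
  congr 2
  ring

/-- Exponential decay beats every power. -/
lemma eventually_exp_le_rpow {ι : Type*} {l : Filter ι} {N : ι → ℕ} (hN : Tendsto N l atTop)
    {γ b : ℝ} (hγ : 0 < γ) (hb : 0 < b) (η a : ℝ) :
    ∀ᶠ n in l, a * Real.exp (-(γ * N n)) ≤ b * (N n : ℝ) ^ (-η) := by
  have h1 := (tendsto_rpow_mul_exp_neg_mul_atTop_nhds_zero η γ hγ).comp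
    (tendsto_natCast_atTop_atTop.comp hN)
  have h2 := (h1.const_mul a).eventually (ge_mem_nhds (by simpa using hb))
  filter_upwards [h2, hN.eventually (eventually_gt_atTop 0)] with n hn hNn
  have hN0 : (0 : ℝ) < N n := by exact_mod_cast hNn
  simp only [Function.comp_apply] at hn
  rw [Real.rpow_neg hN0.le, ← div_eq_mul_inv, le_div_iff₀ (by positivity)]
  calc _ = a * ((N n : ℝ) ^ η * Real.exp (-γ * N n)) := by rw [neg_mul]; ring
    _ ≤ b := hn

namespace Model

variable {Ω : Type*} [MeasurableSpace Ω] {m : Model Ω} {P : Measure Ω}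

/-- The maxima of factors, errors and loading-weighted errors over `ρ` times, in probability. -/
lemma exists_likely_maxima {α β : ℝ} (hα : 2 ≤ α) (hβ : 1 ≤ β) (hF : m.FactorMoments P α)
    (he : m.ErrorMoments P α) (hle : m.LoadingErrorMoments P β) {ι : Type*} {l : Filter ι}
    {N : ι → ℕ} (hN : Tendsto N l atTop) (S : ι → Finset ℕ) {θ : ℝ} (hθ : 0 < θ) :
    ∃ C : ℝ, 1 ≤ C ∧ Likely P l θ fun n ω => ∀ t ∈ S n,
      ‖m.F t ω (m.z t ω)‖ ≤ C * ((S n).card : ℝ) ^ (1 / α) ∧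
      ‖m.errVec (N n) t ω‖ ≤ √(N n) * (C * ((S n).card : ℝ) ^ (1 / α)) ∧
      ∀ j f, |inner ℝ (m.errVec (N n) t ω) (Matrix.toEuclideanLin (m.loading (N n) j) f)|
        ≤ √(N n) * (C * ((S n).card : ℝ) ^ (1 / β)) * ‖f‖ := by
  obtain ⟨M1, hM1⟩ := hF
  obtain ⟨M2, hM2⟩ := he.2
  obtain ⟨M3, hM3⟩ := hle
  set δ := θ / (2 + m.J) with hδ
  have hδ0 : 0 < δ := by positivity
  obtain ⟨C1, hC1, h1⟩ := exists_measure_max_le (P := P) (κ := ℕ) (M := M1)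
    (by linarith : 1 ≤ α) hδ0
  obtain ⟨C2, hC2, h2⟩ := exists_measure_max_le (P := P) (κ := ℕ) (M := M2)
    (by linarith : 1 ≤ α) hδ0
  obtain ⟨C3, hC3, h3⟩ := exists_measure_max_le (P := P) (κ := ℕ) (M := M3) hβ hδ0
  have L1 : Likely P l δ fun n ω => ∀ t ∈ S n,
      ‖m.F t ω (m.z t ω)‖ ≤ C1 * ((S n).card : ℝ) ^ (1 / α) :=
    Eventually.of_forall fun n => h1 (S n) (fun t ω => ‖m.F t ω (m.z t ω)‖)
      m.measurable_norm_factor (fun _ _ => norm_nonneg _) hM1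
  have L2 : Likely P l δ fun n ω => ∀ t ∈ S n,
      ‖m.errVec (N n) t ω‖ / √(N n) ≤ C2 * ((S n).card : ℝ) ^ (1 / α) := by
    filter_upwards [hN.eventually (eventually_gt_atTop 0)] with n hn
    exact h2 (S n) (fun t ω => ‖m.errVec (N n) t ω‖ / √(N n))
      (fun t => (m.measurable_norm_errVec _ t).div_const _) (fun _ _ => by positivity)
      fun t => expNonneg_norm_errVec_le hα hM2 hn t
  have L3 : Likely P l (m.J * δ) fun n ω => ∀ j, ∀ t ∈ S n,
      ‖(Real.sqrt (N n))⁻¹ • ∑ i ∈ Finset.range (N n), m.e i t ω • m.lam j i‖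
        ≤ C3 * ((S n).card : ℝ) ^ (1 / β) := by
    have := Likely.forall (P := P) (l := l) (θ := δ) (p := fun (j : Fin m.J) n ω => ∀ t ∈ S n,
      ‖(Real.sqrt (N n))⁻¹ • ∑ i ∈ Finset.range (N n), m.e i t ω • m.lam j i‖
        ≤ C3 * ((S n).card : ℝ) ^ (1 / β)) fun j => Eventually.of_forall fun n =>
          h3 (S n) _ (fun t => measurable_norm_loading_error (N n) t j) (fun _ _ => norm_nonneg _)
            fun t => hM3 j t (N n)
    simpa using this
  refine ⟨max C1 (max C2 C3), hC1.trans (le_max_left _ _),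
    (((L1.and L2 hδ0.le hδ0.le).and L3 (by positivity) (by positivity)).mono ?_).weaken
      (le_of_eq (by rw [hδ]; field_simp; ring))⟩
  filter_upwards [hN.eventually (eventually_gt_atTop 0)] with n hn ω hω t ht
  have hs : 0 < √(N n : ℝ) := Real.sqrt_pos.2 (by exact_mod_cast hn)
  refine ⟨(hω.1.1 t ht).trans ?_, ?_, fun j f => (abs_inner_errVec_loading_le hn j f).trans ?_⟩
  · gcongr
    exact le_max_left _ _
  · have := hω.1.2 t ht
    rw [div_le_iff₀ hs, mul_comm] at this
    refine this.trans ?_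
    gcongr
    exact (le_max_left _ _).trans (le_max_right _ _)
  · gcongr
    refine (hω.2 j t ht).trans ?_
    gcongr
    exact (le_max_right _ _).trans (le_max_right _ _)

/-- Uniform convergence of the posterior probabilities over sets `S` of times. The two parts of the
theorem are the cases of all times and of a single time. -/
lemma likely_abs_pHat_sub_ind_le [IsProbabilityMeasure P] {q0 : Fin m.J → ℝ} {α β : ℝ}
    (hα : 16 < α) (hβ : 2 ≤ β)
    (h_factor_second : m.FactorSecondMoments P q0) (h_factor_moments : m.FactorMoments P α)
    (h_loadings : m.LoadingLimits) (h_separated : m.RegimesSeparated P)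
    (h_error_moments : m.ErrorMoments P α)
    (h_error_cross : m.ErrorCrossSection P) (h_error_fluct : m.ErrorFluctuation P)
    (h_state : m.StateFrequencies P q0) (h_loading_error : m.LoadingErrorMoments P β)
    {E : m.Estimator} (hE : E.IsQML P) {π : ℕ → ℕ → Ω → Equiv.Perm (Fin m.J)}
    (hπ : ∀ N T ω, (∃ σ, GoodPerm E N T ω σ) → GoodPerm E N T ω (π N T ω))
    {ι : Type*} {l : Filter ι} {N T : ι → ℕ} (hN : Tendsto N l atTop) (hT : Tendsto T l atTop)
    (S : ι → Finset ℕ) (hS : ∀ᶠ n in l, 1 ≤ (S n).card ∧ (S n).card ≤ T n)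
    (hr1 : Tendsto (fun n => ((S n).card : ℝ) ^ (16 / α) / (N n : ℝ)) l (𝓝 0))
    (hr2 : Tendsto (fun n => ((S n).card : ℝ) ^ (2 / α + 2 / β) / (N n : ℝ)) l (𝓝 0))
    (η : ℝ) {b θ : ℝ} (hb : 0 < b) (hθ : 0 < θ) :
    Likely P l θ fun n ω => ∀ t ∈ S n, ∀ j,
      |E.pHat (N n) (T n) t (π (N n) (T n) ω j) ω - m.ind t j ω| ≤ b * (N n : ℝ) ^ (-η) := by
  obtain ⟨c, K, R0, hc, hK, -, hreg⟩ := exists_regularLoadings h_loadings h_separated h_state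
  set δ := θ / 5 with hδ
  have hδ0 : 0 < δ := by positivity
  obtain ⟨Cs, hCs, hs2⟩ := hE.s2_bounded δ hδ0
  obtain ⟨cq, hcq, hq⟩ := hE.q_bounded δ hδ0
  obtain ⟨τ, γ, hτ, hγ, key⟩ := exists_abs_regimeProb_sub_ind_le m hc hK hCs
  obtain ⟨C, hC, hmax⟩ := exists_likely_maxima (by linarith) (by linarith) h_factor_moments
    h_error_moments h_loading_error hN S hδ0
  have hNT : Tendsto (fun n => (N n, T n)) l (atTop ×ˢ atTop) := hN.prodMk hT
  have hperm := (likely_exists_goodPerm (by linarith) h_factor_second h_factor_moments h_loadings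
    h_separated h_error_cross h_error_fluct h_state hE hδ0).comp_tendsto hNT
  have hsep : Likely P l δ fun n ω => ∀ t k, m.z t ω ≠ k → ∀ g,
        c * √(N n : ℝ) ≤ ‖m.common (N n) t ω - Matrix.toEuclideanLin (m.loading (N n) k) g‖ :=
    likely_of_ae ((hN.eventually hreg).mono fun n hn => hn.2)
  have hall := (((((show Likely P _ δ _ from hs2).comp_tendsto hNT).and
    ((show Likely P _ δ _ from hq).comp_tendsto hNT) hδ0.le hδ0.le).and hperm
      (by positivity) hδ0.le).and hsep (by positivity) hδ0.le).and hmax (by positivity) hδ0.le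
  refine (hall.mono ?_).weaken (le_of_eq (by rw [hδ]; ring))
  have hd : Tendsto (fun n => rate (N n, T n)) l (𝓝 0) := tendsto_rate.comp hNT
  have hsm1 : ∀ᶠ n in l, rate (N n, T n) * ((S n).card : ℝ) ^ (2 / α) ≤ τ / C ^ 2 :=
    (tendsto_rate_mul_rpow hT hS hα hr1).eventually (ge_mem_nhds (by positivity))
  have hsm2 : ∀ᶠ n in l, ((S n).card : ℝ) ^ (1 / α + 1 / β) / √(N n : ℝ) ≤ τ / C ^ 2 :=
    (tendsto_rpow_div_sqrt hr2).eventually (ge_mem_nhds (by positivity))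
  filter_upwards [hS, hsm1, hsm2, hd.eventually (ge_mem_nhds (half_pos hc)), hN.eventually hreg,
    hN.eventually (eventually_gt_atTop 0),
    eventually_exp_le_rpow hN hγ hb η cq⁻¹]
    with n hSn hn1 hn2 hn3 hn4 hN0 hexp ω hω t ht j
  obtain ⟨⟨⟨⟨⟨-, hsω⟩, hqω⟩, hpω⟩, hsepω⟩, hmaxω⟩ := hω
  obtain ⟨hr, hfit⟩ := hπ _ _ _ hpω
  obtain ⟨m1, m2, m3⟩ := hmaxω t ht
  have hs : 0 < √(N n : ℝ) := Real.sqrt_pos.2 (by exact_mod_cast hN0)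
  have hρ1 : (1 : ℝ) ≤ (S n).card := by exact_mod_cast hSn.1
  have hρ0 : (0 : ℝ) < (S n).card := by linarith
  have hα0 : 0 < α := by linarith
  have hR : 1 ≤ C * ((S n).card : ℝ) ^ (1 / α) :=
    one_le_mul_of_one_le_of_one_le hC (Real.one_le_rpow hρ1 (by positivity))
  have hC2 : 0 < C ^ 2 := by positivity
  have htime : m.RegularTime (N n) t ω c (rate (N n, T n)) τ (C * ((S n).card : ℝ) ^ (1 / α))
      (C * ((S n).card : ℝ) ^ (1 / β)) (C * ((S n).card : ℝ) ^ (1 / α)) :=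
    { one_le_R := hR
      one_le_Y := hR
      nonneg_X := by positivity
      factor := m1
      error := m2
      loading_error := m3
      separated := fun k hk g => hsepω t k hk g
      rate_d := by
        rw [le_div_iff₀ hC2] at hn1
        have e : ((S n).card : ℝ) ^ (2 / α)
            = ((S n).card : ℝ) ^ (1 / α) * ((S n).card : ℝ) ^ (1 / α) := by
          rw [← Real.rpow_add hρ0]; congr 1; ring
        rw [e] at hn1
        linarith
      rate_X := by
        rw [div_le_iff₀ hs, div_mul_eq_mul_div, le_div_iff₀ hC2, Real.rpow_add hρ0] at hn2
        linarith }
  exact (key (N n) t ω (E.Lhat (N n) (T n) ω) (E.s2 (N n) (T n) ω) (rate (N n, T n))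
    (E.q (N n) (T n) ω) (π (N n) (T n) ω) cq _ R0 _ _ hN0 hn4.1 hfit hr (rate_nonneg _) hn3 htime
    (hE.s2_pos _ _ _) hsω hcq (hE.q_pos _ _ _) (hE.q_sum _ _ _) hqω j).trans hexp

end Model

end RegimeFactor

end

theorem theorem2 {Ω : Type*} [MeasurableSpace Ω] (P : Measure Ω) [IsProbabilityMeasure P]
    (m : RegimeFactor.Model Ω) (q0 : Fin m.J → ℝ) (α β : ℝ) (hα : 16 < α) (hβ : 2 ≤ β)
    (h_factor_second : m.FactorSecondMoments P q0)
    (h_factor_moments : m.FactorMoments P α)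
    (h_loadings : m.LoadingLimits)
    (h_separated : m.RegimesSeparated P)
    (h_error_moments : m.ErrorMoments P α)
    (h_error_cross : m.ErrorCrossSection P)
    (h_error_serial : m.ErrorSerial P)
    (h_error_fluct : m.ErrorFluctuation P)
    (h_state : m.StateFrequencies P q0)
    (h_loading_error : m.LoadingErrorMoments P β)
    (E : m.Estimator) (hE : E.IsQML P) :
    -- the labels of the estimated regimes are identified only up to a permutation
    ∃ π : ℕ → ℕ → Ω → Equiv.Perm (Fin m.J),
      (∀ N T ω j, m.r (π N T ω j) = m.r j) ∧
      -- (1) uniformly over `t < T`, along any `(N, T) → ∞` with the two rate conditions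
      (∀ (j : Fin m.J) (η : ℝ), 0 < η → ∀ N T : ℕ → ℕ,
        Tendsto N atTop atTop → Tendsto T atTop atTop →
        Tendsto (fun n => (T n : ℝ) ^ (16 / α) / (N n : ℝ)) atTop (𝓝 0) →
        Tendsto (fun n => (T n : ℝ) ^ (2 / α + 2 / β) / (N n : ℝ)) atTop (𝓝 0) →
        RegimeFactor.IsLittleOp P atTop
          (fun n ω => ⨆ t : Fin (T n),
            |E.pHat (N n) (T n) (t : ℕ) (π (N n) (T n) ω j) ω - m.ind (t : ℕ) j ω|)
          (fun n => (N n : ℝ) ^ (-η))) ∧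
      -- (2) for each single time `t` (fixed, or varying with the sample size), as `(N, T) → ∞`
      (∀ (j : Fin m.J) (η : ℝ), 0 < η → ∀ t : ℕ × ℕ → ℕ,
        (∀ᶠ n : ℕ × ℕ in atTop ×ˢ atTop, t n < n.2) →
        RegimeFactor.IsLittleOp P (atTop ×ˢ atTop)
          (fun n ω => |E.pHat n.1 n.2 (t n) (π n.1 n.2 ω j) ω - m.ind (t n) j ω|)
          (fun n => (n.1 : ℝ) ^ (-η))) := by

  -- the relabeling depends on the sample only; without a good one, the identity is a dummy value
  open RegimeFactor RegimeFactor.Model in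
  have hex : ∀ N T ω, ∃ σ : Equiv.Perm (Fin m.J), (∀ j, m.r (σ j) = m.r j) ∧
      ((∃ σ', GoodPerm E N T ω σ') → GoodPerm E N T ω σ) := by
    intro N T ω
    by_cases h : ∃ σ', GoodPerm E N T ω σ'
    · obtain ⟨σ, hσ⟩ := h
      exact ⟨σ, hσ.1, fun _ => hσ⟩
    · exact ⟨Equiv.refl _, fun _ => rfl, fun h' => absurd h' h⟩
  choose π hr hπ using hex
  refine ⟨π, hr, ?_, ?_⟩
  · intro j η _ N T hN hT h1 h2
    refine tendstoInMeasure_iff_norm.2 fun ε hε => ?_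
    have key := RegimeFactor.Likely.tendsto fun θ hθ =>
      RegimeFactor.Model.likely_abs_pHat_sub_ind_le hα hβ h_factor_second h_factor_moments h_loadings
        h_separated h_error_moments h_error_cross h_error_fluct h_state h_loading_error hE hπ hN hT
        (fun n => Finset.range (T n))
        (by filter_upwards [hT.eventually (eventually_ge_atTop 1)] with n hn; simpa using hn)
        (by simpa using h1) (by simpa using h2) η (half_pos hε) hθ
    refine tendsto_of_tendsto_of_tendsto_of_le_of_le' tendsto_const_nhds key
      (Eventually.of_forall fun _ => zero_le) ?_
    filter_upwards [hN.eventually (eventually_gt_atTop 0)] with n hn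
    refine measure_mono fun ω hω hcon => ?_
    have hpos : 0 < (N n : ℝ) ^ (-η) := Real.rpow_pos_of_pos (by exact_mod_cast hn) _
    have hle : (⨆ t : Fin (T n),
        |E.pHat (N n) (T n) (t : ℕ) (π (N n) (T n) ω j) ω - m.ind (t : ℕ) j ω|)
          ≤ ε / 2 * (N n : ℝ) ^ (-η) :=
      Real.iSup_le (fun t => hcon t (Finset.mem_range.2 t.2) j) (by positivity)
    have h0 : 0 ≤ ⨆ t : Fin (T n),
        |E.pHat (N n) (T n) (t : ℕ) (π (N n) (T n) ω j) ω - m.ind (t : ℕ) j ω| :=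
      Real.iSup_nonneg fun _ => abs_nonneg _
    have hω' : ε ≤ ‖_ / (N n : ℝ) ^ (-η) - 0‖ := hω
    rw [sub_zero, Real.norm_of_nonneg (div_nonneg h0 hpos.le), le_div_iff₀ hpos] at hω'
    nlinarith
  -- a single time is a set with one element, for which both growth conditions read `1 / N → 0`
  · intro j η _ t _
    refine tendstoInMeasure_iff_norm.2 fun ε hε => ?_
    have hinv : Tendsto (fun n : ℕ × ℕ => (1 : ℝ) / (n.1 : ℝ)) (atTop ×ˢ atTop) (𝓝 0) :=
      tendsto_one_div_atTop_nhds_zero_nat.comp tendsto_fst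
    have key := RegimeFactor.Likely.tendsto fun θ hθ =>
      RegimeFactor.Model.likely_abs_pHat_sub_ind_le hα hβ h_factor_second h_factor_moments h_loadings
        h_separated h_error_moments h_error_cross h_error_fluct h_state h_loading_error hE hπ
        (tendsto_fst (f := (atTop : Filter ℕ)) (g := (atTop : Filter ℕ))) tendsto_snd
        (fun n => {t n})
        (by
          filter_upwards [tendsto_snd.eventually (eventually_ge_atTop 1)] with n hn
          simpa using hn)
        (by simpa using hinv) (by simpa using hinv) η (half_pos hε) hθ
    refine tendsto_of_tendsto_of_tendsto_of_le_of_le' tendsto_const_nhds key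
      (Eventually.of_forall fun _ => zero_le) ?_
    filter_upwards [tendsto_fst.eventually (eventually_gt_atTop 0)] with n hn
    refine measure_mono fun ω hω hcon => ?_
    have hpos : 0 < (n.1 : ℝ) ^ (-η) := Real.rpow_pos_of_pos (by exact_mod_cast hn) _
    have hle := hcon (t n) (Finset.mem_singleton_self _) j
    have hω' : ε ≤ ‖_ / (n.1 : ℝ) ^ (-η) - 0‖ := hω
    rw [sub_zero, Real.norm_of_nonneg (div_nonneg (abs_nonneg _) hpos.le), le_div_iff₀ hpos] at hω'
    nlinarith
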